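/- Let $n\ge 3$, let $\sigma$ be the surface measure on the unit sphere $\mathbb S^{n-1}\subset\mathbb R^n$ normalized by $\sigma(\mathbb S^{n-1})=1$, and let $\mathbb B^n$ be the open unit ball. For $\alpha<1$ put $$C_{n,\alpha}=\frac{\Gamma\left(\frac{n-\alpha}{2}\right)\Gamma\left(1-\frac{\alpha}{2}\right)}{\Gamma\left(\frac n2\right)\Gamma(1-\alpha)},\qquad P_\alpha[\phi](x)=C_{n,\alpha}\int_{\mathbb S^{n-1}}\frac{(1-|x|^2)^{1-\alpha}}{|x-\zeta|^{n-\alpha}}\,\phi(\zeta)\,d\sigma(\zeta)\quad(x\in\mathbb B^n).$$ For $q\in[1,\infty)$, $x\in\mathbb B^n$ and $l\in\mathbb S^{n-1}$ put $$I(\alpha,q,x,l)=\int_{\mathbb S^{n-1}}|\eta-x|^{(n-\alpha)q-2n+2}\,|\langle\eta,l\rangle|^q\,d\sigma(\eta),$$ $$J(\alpha,q,x)=q|x|\frac{|2-\alpha-n|}{n-\alpha}\left(1+\frac{|2-\alpha-n|}{n-\alpha}|x|\right)^{q-1}{}_2F_1\left(n-1-\frac{q(n-\alpha)}2,\frac{n-q(n-\alpha)}2;\frac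 n2;|x|^2\right),$$ $$K_{\alpha,q}(x)=\frac{(n-\alpha)C_{n,\alpha}}{(1-|x|^2)^{\frac{n(q-1)+1}{q}}}\left(\sup_{l\in\mathbb S^{n-1}}I(\alpha,q,x,l)+J(\alpha,q,x)\right)^{1/q}.$$ **Theorem 1.1.** Let $n\ge3$, $\alpha<1$, $p\in(1,\infty]$ with conjugate exponent $q$ (so $\frac1p+\frac1q=1$ and $q\in[1,\infty)$), and let $x\in\mathbb B^n$. (a) If $\phi\in L^p(\mathbb S^{n-1},\mathbb R)$ and $u=P_\alpha[\phi]$, then $u$ is differentiable at $x$ and $$|\nabla u(x)|\le K_{\alpha,q}(x)\,\|\phi\|_{L^p(\mathbb S^{n-1},\mathbb R)}.$$ (b) The supremum is finite and given by: (1) if $q=\frac{2n-2}{n-\alpha}$, then $$\sup_l I(\alpha,q,x,l)=\frac{\Gamma\left(\frac n2\right)\Gamma\left(\frac{3n-\alpha-2}{2n-2\alpha}\right)}{\sqrt\pi\,\Gamma\left(\frac{n^2+2n-\alpha n-2}{2n-2\alpha}\right)};$$ (2) if $q=\frac{2n}{n-\alpha}$, then $$\sup_l I(\alpha,q,x,l)=\frac{\Gamma\left(\frac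 n2\right)\Gamma\left(\frac{3n-\alpha}{2n-2\alpha}\right)}{\sqrt\pi\,\Gamma\left(\frac{n^2+2n-\alpha n}{2n-2\alpha}\right)}(1+|x|^2);$$ (3) if $\frac{2n-2}{n-\alpha}<q<\frac{2n}{n-\alpha}$, then $$\sup_l I(\alpha,q,x,l)=\frac{\Gamma\left(\frac n2\right)\Gamma\left(\frac{q+1}2\right)}{\sqrt\pi\,\Gamma\left(\frac{q+n}2\right)}\,{}_2F_1\left(n-1-\frac{(n-\alpha)q}2,\frac{n-(n+1-\alpha)q}2;\frac{q+n}2;|x|^2\right);$$ (4) if $1\le q<\frac{2n-2}{n-\alpha}$ or $q>\frac{2n}{n-\alpha}$, then $$\sup_l I(\alpha,q,x,l)=(1+|x|^2)^{\frac{(n-\alpha)q}2-n+1}\frac{\Gamma\left(\frac n2\right)\Gamma\left(\frac{q+1}2\right)}{\sqrt\pi\,\Gamma\left(\frac{q+n}2\right)}\,{}_3F_2\left(\frac{2n-2-(n-\alpha)q}4,\frac{2n-(n-\alpha)q}4,\frac{q+1}2;\frac12,\frac{q+n}2;\frac{4|x|^2}{(1+|x|^2)^2}\right).$$ (c) (Sharpness.)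 If $x=0$ or $\alpha=2-n$, then $K_{\alpha,q}(x)$ is the smallest real number $K$ such that $|\nabla P_\alpha[\phi](x)|\le K\|\phi\|_{L^p(\mathbb S^{n-1},\mathbb R)}$ for all $\phi\in L^p(\mathbb S^{n-1},\mathbb R)$. -/

import Mathlib

open MeasureTheory Metric

noncomputable section

namespace AlphaHarmonic

/-- The unit sphere of `n`-dimensional Euclidean space. -/
abbrev Sph (n : ℕ) : Type := sphere (0 : EuclideanSpace ℝ (Fin n)) 1

/-- The surface measure on the unit sphere, normalized to total mass one. -/
def sigma (n : ℕ) : Measure (Sph n) :=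
  ((volume : Measure (EuclideanSpace ℝ (Fin n))).toSphere Set.univ)⁻¹ •
    (volume : Measure (EuclideanSpace ℝ (Fin n))).toSphere

/-- The normalizing constant of the Poisson-Szegő kernel. -/
def cConst (n : ℕ) (α : ℝ) : ℝ :=
  Real.Gamma (((n : ℝ) - α) / 2) * Real.Gamma (1 - α / 2) /
    (Real.Gamma ((n : ℝ) / 2) * Real.Gamma (1 - α))

/-- The Poisson-Szegő kernel `P_α(x, ζ)`. -/
def kernel (n : ℕ) (α : ℝ) (x ζ : EuclideanSpace ℝ (Fin n)) : ℝ :=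
  cConst n α * ((1 - ‖x‖ ^ 2) ^ (1 - α) / ‖x - ζ‖ ^ ((n : ℝ) - α))

/-- The Poisson-Szegő integral `P_α[φ]`. -/
def poisson (n : ℕ) (α : ℝ) (φ : Sph n → ℝ) (x : EuclideanSpace ℝ (Fin n)) : ℝ :=
  ∫ ζ : Sph n, kernel n α x ζ * φ ζ ∂(sigma n)

/-- The norm of a real function in `L^p` of the unit sphere. -/
def lpNorm (n : ℕ) (p : ENNReal) (φ : Sph n → ℝ) : ℝ :=
  (eLpNorm φ p (sigma n)).toReal

/-- The generalized hypergeometric series `₃F₂(a₁, a₂, a₃; b₁, b₂; s)`. -/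
def hyp32 (a₁ a₂ a₃ b₁ b₂ s : ℝ) : ℝ :=
  ∑' k : ℕ,
    ((ascPochhammer ℝ k).eval a₁ * (ascPochhammer ℝ k).eval a₂ * (ascPochhammer ℝ k).eval a₃) /
      ((ascPochhammer ℝ k).eval b₁ * (ascPochhammer ℝ k).eval b₂) * (s ^ k / (k.factorial : ℝ))

/-- The spherical integral `I(α, q, x, l)`. -/
def intI (n : ℕ) (α q : ℝ) (x : EuclideanSpace ℝ (Fin n)) (l : Sph n) : ℝ :=
  ∫ η : Sph n,
    ‖(η : EuclideanSpace ℝ (Fin n)) - x‖ ^ (((n : ℝ) - α) * q - 2 * (n : ℝ) + 2) *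
      |inner ℝ (η : EuclideanSpace ℝ (Fin n)) (l : EuclideanSpace ℝ (Fin n))| ^ q ∂(sigma n)

/-- The correction term `J(α, q, x)`. -/
def termJ (n : ℕ) (α q : ℝ) (x : EuclideanSpace ℝ (Fin n)) : ℝ :=
  q * ‖x‖ * (|2 - α - (n : ℝ)| / ((n : ℝ) - α)) *
    (1 + |2 - α - (n : ℝ)| / ((n : ℝ) - α) * ‖x‖) ^ (q - 1) *
    ordinaryHypergeometric ((n : ℝ) - 1 - q * ((n : ℝ) - α) / 2)
      (((n : ℝ) - q * ((n : ℝ) - α)) / 2) ((n : ℝ) / 2) (‖x‖ ^ 2)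

/-- The factor in front of the `L^p` norm in the gradient estimate. -/
def gradBound (n : ℕ) (α q : ℝ) (x : EuclideanSpace ℝ (Fin n)) : ℝ :=
  ((n : ℝ) - α) * cConst n α / (1 - ‖x‖ ^ 2) ^ (((n : ℝ) * (q - 1) + 1) / q) *
    ((⨆ l : Sph n, intI n α q x l) + termJ n α q x) ^ (1 / q)

end AlphaHarmonic

end

/-! The gradient estimate is an `L^p`–`L^q` duality statement. For fixed `x` and a unit vector `l`,
the derivative of `P_α[φ]` at `x` along `l` is the integral of `φ` against `⟨∇P_α(x, ζ), l⟩`, so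
everything depends on the `L^q` norm of that function of `ζ`.

The norm is computed by the substitution `ζ = chordMap x η`, where `η` and `ζ` are the two ends of a
chord through `x`. This is an involution of the sphere with Jacobian `((1 - |x|²) / |η - x|²)^(n-1)`
(`integral_sigma_chordMap`), and it turns the kernel gradient into a scalar multiple of `|η -
x|^(n-α) (η - β x)` with `β = (n - 2 + α) / (n - α)` (`kernelGrad_chordMap`). If `β x = 0` the
integral left over is exactly `I(α, q, x, l)`; otherwise the shift `β x` is paid for by `J`, through
`(A + B)^q ≤ A^q + q B (A + B)^(q-1)`. Hölder gives the estimate; its extremal functions give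
sharpness when `β x = 0`, that is, when `x = 0` or `α = 2 - n`.

For the supremum of `I`, put `a = ((n - α) q - 2n + 2) / 2`, `r = |x|` and `x = r e`. Only the even
part of `η ↦ |η - x|^(2a)` counts, and this is a function of `|⟨η, e⟩|`: increasing if `t^a` is
convex (`a ≤ 0` or `a ≥ 1`), decreasing if it is concave (`0 ≤ a ≤ 1`). A reflection argument
(`integral_mul_le_of_swap`) then shows that the maximum is reached at `l = e` in the convex case and
at `l ⟂ e` in the concave case. The thresholds for `q` are `a = 0` and `a = 1`, where `I` does not
depend on `l`.

The extremal integrals come from the binomial series and Gaussian moments on the sphere. For `l = e`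
this is a `₃F₂`. For `l ⟂ e` it collapses to a `₂F₁` in `4r² / (1 + r²)²`, which the quadratic
transformation `quadratic_transformation` rewrites as a `₂F₁` in `r²`. -/

namespace AlphaHarmonic

/-! ### Integration on the sphere: polar coordinates, isometry invariance, moments. -/

section Sphere

/-- Polar coordinates for a radial factor times an angular factor. No integrability is needed,
because the integral of such a product over a product measure always factors. -/
theorem integral_norm_mul_direction {E : Type*} [NormedAddCommGroup E] [NormedSpace ℝ E]
    [MeasurableSpace E] [BorelSpace E] [FiniteDimensional ℝ E] [Nontrivial E] (μ : Measure E)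
    [μ.IsAddHaarMeasure] (f : ℝ → ℝ) (G : E → ℝ) :
    ∫ y, f ‖y‖ * G (‖y‖⁻¹ • y) ∂μ =
      (∫ η : sphere (0 : E) 1, G η ∂μ.toSphere) *
        ∫ r in Set.Ioi (0 : ℝ), r ^ (Module.finrank ℝ E - 1) * f r :=
  calc
    ∫ y, f ‖y‖ * G (‖y‖⁻¹ • y) ∂μ
      = ∫ y : ({(0)}ᶜ : Set E), f ‖y.1‖ * G (‖y.1‖⁻¹ • y.1) ∂(μ.comap (↑)) := by
      rw [integral_subtype_comap (measurableSet_singleton _).compl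
        fun y ↦ f (‖y‖) * G (‖y‖⁻¹ • y), restrict_compl_singleton]
    _ = ∫ z, G z.1 * f z.2 ∂μ.toSphere.prod (.volumeIoiPow (Module.finrank ℝ E - 1)) := by
      simpa [mul_comm] using μ.measurePreserving_homeomorphUnitSphereProd.integral_comp
        (Homeomorph.measurableEmbedding _)
        (fun z : sphere (0 : E) 1 × Set.Ioi (0 : ℝ) => G z.1 * f z.2)
    _ = (∫ η : sphere (0 : E) 1, G η ∂μ.toSphere) *
        ∫ r : Set.Ioi (0 : ℝ), f r ∂.volumeIoiPow (Module.finrank ℝ E - 1) :=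
      integral_prod_mul (fun η : sphere (0 : E) 1 => G η) (fun r : Set.Ioi (0 : ℝ) => f r)
    _ = _ := by
      simp only [Measure.volumeIoiPow, ENNReal.ofReal]
      rw [integral_withDensity_eq_integral_smul,
        integral_subtype_comap measurableSet_Ioi fun a ↦
          Real.toNNReal (a ^ (Module.finrank ℝ E - 1)) • f a,
        setIntegral_congr_fun measurableSet_Ioi fun x hx ↦ ?_]
      · rw [NNReal.smul_def, Real.coe_toNNReal _ (pow_nonneg hx.out.le _), smul_eq_mul]
      · exact (measurable_subtype_coe.pow_const _).real_toNNReal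

theorem integral_sigma {n : ℕ} (G : Sph n → ℝ) :
    ∫ η, G η ∂sigma n = ((volume : Measure (EuclideanSpace ℝ (Fin n))).toSphere.real Set.univ)⁻¹ *
      ∫ η, G η ∂(volume : Measure (EuclideanSpace ℝ (Fin n))).toSphere := by
  rw [sigma, integral_smul_measure, smul_eq_mul, ENNReal.toReal_inv]
  rfl

variable {n : ℕ} [NeZero n]

instance : IsProbabilityMeasure (sigma n) := by
  constructor
  rw [sigma, Measure.smul_apply, smul_eq_mul]
  refine ENNReal.inv_mul_cancel ?_ (measure_ne_top _ _)
  rw [ne_eq, Measure.measure_univ_eq_zero]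
  exact Measure.toSphere_ne_zero _

theorem toSphere_real_univ_pos :
    0 < (volume : Measure (EuclideanSpace ℝ (Fin n))).toSphere.real Set.univ := by
  have : (volume : Measure (EuclideanSpace ℝ (Fin n))).toSphere ≠ 0 := Measure.toSphere_ne_zero _
  have : NeZero (volume : Measure (EuclideanSpace ℝ (Fin n))).toSphere := ⟨this⟩
  exact measureReal_univ_pos

/-- Extending `G` radially moves integrals over the sphere to Lebesgue integrals over the ball,
where isometry invariance and the Jacobian formula are available. -/
theorem integral_sigma_eq_integral_ball (G : EuclideanSpace ℝ (Fin n) → ℝ) :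
    ∫ η : Sph n, G η ∂sigma n = (volume.real (ball (0 : EuclideanSpace ℝ (Fin n)) 1))⁻¹ *
      ∫ y in ball (0 : EuclideanSpace ℝ (Fin n)) 1, G (‖y‖⁻¹ • y) := by
  have h := integral_norm_mul_direction (volume : Measure (EuclideanSpace ℝ (Fin n)))
    (Set.indicator (Set.Iio 1) 1) G
  have h1 : ∫ r in Set.Ioi (0 : ℝ), r ^ (n - 1) * (Set.Iio (1 : ℝ)).indicator 1 r = (n : ℝ)⁻¹ := by
    have : ∀ r : ℝ, r ^ (n - 1) * (Set.Iio (1 : ℝ)).indicator 1 r =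
        (Set.Iio (1 : ℝ)).indicator (fun r => r ^ (n - 1)) r := by
      intro r
      by_cases hr : r < 1 <;> simp [hr]
    simp_rw [this]
    rw [setIntegral_indicator measurableSet_Iio, Set.Ioi_inter_Iio, ← integral_Ioc_eq_integral_Ioo,
      ← intervalIntegral.integral_of_le zero_le_one, integral_pow]
    have hn := Nat.pos_of_neZero n
    rw [Nat.sub_add_cancel hn, Nat.cast_sub hn]
    simp [(NeZero.ne n)]
  have h2 : ∫ y : EuclideanSpace ℝ (Fin n), (Set.Iio (1 : ℝ)).indicator 1 ‖y‖ * G (‖y‖⁻¹ • y) =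
      ∫ y in ball (0 : EuclideanSpace ℝ (Fin n)) 1, G (‖y‖⁻¹ • y) := by
    rw [← integral_indicator measurableSet_ball]
    congr with y
    by_cases hr : ‖y‖ < 1 <;> simp [hr]
  rw [finrank_euclideanSpace_fin, h1, h2] at h
  rw [h, integral_sigma, Measure.toSphere_real_apply_univ, finrank_euclideanSpace_fin]
  field_simp

theorem integral_sigma_comp_isometry (R : EuclideanSpace ℝ (Fin n) ≃ₗᵢ[ℝ] EuclideanSpace ℝ (Fin n))
    (G : EuclideanSpace ℝ (Fin n) → ℝ) :
    ∫ η : Sph n, G (R η) ∂sigma n = ∫ η : Sph n, G η ∂sigma n := by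
  rw [integral_sigma_eq_integral_ball (fun y => G (R y)), integral_sigma_eq_integral_ball]
  congr 1
  have h := R.measurePreserving.setIntegral_preimage_emb R.toHomeomorph.measurableEmbedding
    (fun y => G (‖y‖⁻¹ • y)) (ball 0 1)
  rw [← h]
  have : R ⁻¹' ball 0 1 = ball 0 1 := by ext; simp
  rw [this]
  simp

theorem integral_abs_rpow_mul_exp_neg_sq {c : ℝ} (hc : 0 ≤ c) :
    ∫ t : ℝ, |t| ^ c * Real.exp (-t ^ 2) = Real.Gamma ((c + 1) / 2) := by
  have h := integral_comp_abs (f := fun t => t ^ c * Real.exp (-t ^ (2 : ℝ)))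
  have h2 := integral_rpow_mul_exp_neg_rpow (p := 2) (q := c) two_pos (by linarith)
  rw [h2] at h
  simp only [Real.rpow_two, sq_abs] at h
  rw [h]; ring

/-- The Gaussian trick: `∏ |y_k|^(c k) · exp(-|y|²)` is integrated over the whole space once as a
product of one-dimensional integrals and once in polar coordinates. -/
theorem integral_sigma_prod_abs_rpow
    (b : OrthonormalBasis (Fin n) ℝ (EuclideanSpace ℝ (Fin n))) {c : Fin n → ℝ}
    (hc : ∀ k, 0 ≤ c k) :
    ∫ η : Sph n, ∏ k, |inner ℝ (b k) (η : EuclideanSpace ℝ (Fin n))| ^ c k ∂sigma n =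
      Real.Gamma (n / 2) / Real.Gamma ((n + ∑ k, c k) / 2) *
        ∏ k, (Real.Gamma ((c k + 1) / 2) / √Real.pi) := by
  have hn : (0 : ℝ) < n := Nat.cast_pos.2 (Nat.pos_of_neZero n)
  have key : ∀ c : Fin n → ℝ, (∀ k, 0 ≤ c k) →
      ∏ k, Real.Gamma ((c k + 1) / 2) =
      (∫ η : Sph n, ∏ k, |inner ℝ (b k) (η : EuclideanSpace ℝ (Fin n))| ^ c k
        ∂(volume : Measure (EuclideanSpace ℝ (Fin n))).toSphere) *
        (1 / 2 * Real.Gamma ((n + ∑ k, c k) / 2)) := by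
    intro c hc
    have hs : 0 ≤ ∑ k, c k := Finset.sum_nonneg fun k _ => hc k
    have h := integral_norm_mul_direction (volume : Measure (EuclideanSpace ℝ (Fin n)))
      (fun r => r ^ (∑ k, c k) * Real.exp (-r ^ 2))
      (fun y => ∏ k, |inner ℝ (b k) y| ^ c k)
    have h1 : ∫ r in Set.Ioi (0 : ℝ), r ^ (n - 1) * (r ^ (∑ k, c k) * Real.exp (-r ^ 2)) =
        1 / 2 * Real.Gamma ((n + ∑ k, c k) / 2) := by
      have h2 := integral_rpow_mul_exp_neg_rpow (p := 2) (q := n - 1 + ∑ k, c k) two_pos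
        (by linarith)
      rw [show (n : ℝ) - 1 + ∑ k, c k + 1 = n + ∑ k, c k by ring] at h2
      rw [← h2]
      refine setIntegral_congr_fun measurableSet_Ioi fun r hr => ?_
      have hn' := Nat.pos_of_neZero n
      simp only [Real.rpow_two]
      rw [← mul_assoc, Real.rpow_add hr, ← Real.rpow_natCast, Nat.cast_sub hn', Nat.cast_one]
    have h3 : ∫ y : EuclideanSpace ℝ (Fin n), ‖y‖ ^ (∑ k, c k) * Real.exp (-‖y‖ ^ 2) *
        ∏ k, |inner ℝ (b k) (‖y‖⁻¹ • y)| ^ c k = ∏ k, Real.Gamma ((c k + 1) / 2) := by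
      have h4 : ∀ y : EuclideanSpace ℝ (Fin n), ‖y‖ ^ (∑ k, c k) * Real.exp (-‖y‖ ^ 2) *
          ∏ k, |inner ℝ (b k) (‖y‖⁻¹ • y)| ^ c k =
          (fun z : EuclideanSpace ℝ (Fin n) => (fun z : Fin n → ℝ =>
            ∏ k, (|z k| ^ c k * Real.exp (-(z k) ^ 2))) (WithLp.ofLp z)) (b.repr y) := by
        intro y
        simp only [Finset.prod_mul_distrib, OrthonormalBasis.repr_apply_apply]
        rw [← Real.exp_sum]
        have e1 : ∑ k, -(inner ℝ (b k) y) ^ 2 = -‖y‖ ^ 2 := by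
          rw [Finset.sum_neg_distrib, ← b.sum_sq_norm_inner_right y]
          simp
        rw [e1, Real.rpow_sum_of_nonneg (norm_nonneg y) fun k _ => hc k, mul_right_comm,
          ← Finset.prod_mul_distrib]
        congr 1
        refine Finset.prod_congr rfl fun k _ => ?_
        rw [← Real.mul_rpow (norm_nonneg y) (abs_nonneg _)]
        congr 1
        rw [inner_smul_right, abs_mul, abs_of_nonneg (inv_nonneg.2 (norm_nonneg y)), ← mul_assoc]
        rcases eq_or_ne y 0 with rfl | hy
        · simp
        · rw [mul_inv_cancel₀ (norm_ne_zero_iff.2 hy), one_mul]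
      simp_rw [h4]
      rw [b.measurePreserving_repr.integral_comp b.repr.toHomeomorph.measurableEmbedding
        (fun z : EuclideanSpace ℝ (Fin n) => (fun z : Fin n → ℝ =>
            ∏ k, (|z k| ^ c k * Real.exp (-(z k) ^ 2))) (WithLp.ofLp z)),
        (PiLp.volume_preserving_ofLp (Fin n)).integral_comp
          (MeasurableEquiv.toLp 2 (Fin n → ℝ)).symm.measurableEmbedding
          (fun z : Fin n → ℝ => ∏ k, (|z k| ^ c k * Real.exp (-(z k) ^ 2))),
        integral_fintype_prod_volume_eq_prod (fun k t => |t| ^ c k * Real.exp (-t ^ 2))]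
      exact Finset.prod_congr rfl fun k _ => integral_abs_rpow_mul_exp_neg_sq (hc k)
    rw [finrank_euclideanSpace_fin, h1] at h
    rw [← h3, ← h]
  have k1 := key c hc
  -- Zero exponents give the total mass of the sphere, which is what normalizing by `sigma`
  -- requires.
  have k0 := key 0 (fun _ => le_rfl)
  simp only [Pi.zero_apply, zero_add, Finset.prod_const, Finset.card_univ, Fintype.card_fin,
    Real.rpow_zero, one_pow, integral_const, smul_eq_mul, mul_one, Finset.sum_const_zero, add_zero,
    Real.Gamma_one_half_eq] at k0
  rw [integral_sigma, Finset.prod_div_distrib, k1, Finset.prod_const, Finset.card_univ,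
    Fintype.card_fin, k0]
  have hS := toSphere_real_univ_pos (n := n)
  have hg1 : 0 < Real.Gamma (n / 2) := Real.Gamma_pos_of_pos (by positivity)
  have hs : 0 ≤ ∑ k, c k := Finset.sum_nonneg fun k _ => hc k
  have hg2 : 0 < Real.Gamma ((n + ∑ k, c k) / 2) := Real.Gamma_pos_of_pos (by positivity)
  field_simp

theorem integral_sigma_abs_rpow_mul_abs_rpow {e m : EuclideanSpace ℝ (Fin n)} (he : ‖e‖ = 1)
    (hm : ‖m‖ = 1) (hem : inner ℝ e m = 0) {A B : ℝ} (hA : 0 ≤ A) (hB : 0 ≤ B) :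
    ∫ η : Sph n, |inner ℝ (η : EuclideanSpace ℝ (Fin n)) e| ^ A *
        |inner ℝ (η : EuclideanSpace ℝ (Fin n)) m| ^ B ∂sigma n =
      Real.Gamma (n / 2) * Real.Gamma ((A + 1) / 2) * Real.Gamma ((B + 1) / 2) /
        (Real.pi * Real.Gamma ((n + (A + B)) / 2)) := by
  have hne : e ≠ m := by
    rintro rfl
    rw [real_inner_self_eq_norm_sq, he] at hem
    norm_num at hem
  have hort : Orthonormal ℝ ((↑) : ({e, m} : Set (EuclideanSpace ℝ (Fin n))) →
      EuclideanSpace ℝ (Fin n)) := by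
    refine orthonormal_subtype_iff_ite.2 ?_
    rintro v hv w hw
    have hme : inner ℝ m e = 0 := by rw [real_inner_comm]; exact hem
    rcases hv with rfl | rfl <;> rcases hw with rfl | rfl <;>
      simp [hem, hme, hne, hne.symm, he, hm]
  obtain ⟨u, b₀, hu, hb₀⟩ := hort.exists_orthonormalBasis_extension
  have hcard : Fintype.card u = n := by
    have := Module.finrank_eq_card_basis b₀.toBasis
    rw [finrank_euclideanSpace_fin] at this
    exact this.symm
  let φ : u ≃ Fin n := Fintype.equivFinOfCardEq hcard
  let b := b₀.reindex φ
  let i := φ ⟨e, by exact_mod_cast hu (by simp)⟩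
  let j := φ ⟨m, by exact_mod_cast hu (by simp)⟩
  have hbi : b i = e := by simp [b, i, hb₀]
  have hbj : b j = m := by simp [b, j, hb₀]
  have hij : i ≠ j := fun h => hne (by rw [← hbi, ← hbj, h])
  let c : Fin n → ℝ := fun k => if k = i then A else if k = j then B else 0
  have hci : c i = A := by simp [c]
  have hcj : c j = B := by simp [c, hij.symm]
  have hck : ∀ k, k ≠ i ∧ k ≠ j → c k = 0 := fun k hk => by simp [c, hk.1, hk.2]
  have h := integral_sigma_prod_abs_rpow b (c := c) (fun k => by
    simp only [c]; split_ifs <;> first | assumption | exact le_rfl)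
  have hp : ∀ η : EuclideanSpace ℝ (Fin n), ∏ k, |inner ℝ (b k) η| ^ c k =
      |inner ℝ η e| ^ A * |inner ℝ η m| ^ B := by
    intro η
    rw [Finset.prod_eq_mul i j hij (fun k _ hk => by rw [hck k hk, Real.rpow_zero]) (by simp)
      (by simp), hci, hcj, hbi, hbj, real_inner_comm, real_inner_comm m]
  have hs : ∑ k, c k = A + B := by
    rw [Finset.sum_eq_add i j hij (fun k _ hk => hck k hk) (by simp) (by simp), hci, hcj]
  have hg : ∏ k, (Real.Gamma ((c k + 1) / 2) / √Real.pi) =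
      Real.Gamma ((A + 1) / 2) / √Real.pi * (Real.Gamma ((B + 1) / 2) / √Real.pi) := by
    rw [Finset.prod_eq_mul i j hij (fun k _ hk => ?_) (by simp) (by simp), hci, hcj]
    rw [hck k hk, zero_add, Real.Gamma_one_half_eq, div_self (by positivity)]
  simp_rw [hp] at h
  rw [h, hs, hg]
  have : √Real.pi * √Real.pi = Real.pi := Real.mul_self_sqrt Real.pi_pos.le
  rw [div_mul_div_comm, this, div_mul_div_comm, mul_comm Real.pi, mul_assoc]

end Sphere

/-! ### The chord involution of the sphere and its Jacobian. -/

section Chord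

theorem one_sub_norm_sq_pos {E : Type*} [NormedAddCommGroup E] {x : E} (hx : ‖x‖ < 1) : 0 < 1 - ‖x‖ ^ 2 := by
  have := norm_nonneg x
  nlinarith

theorem norm_sub_pos_of_norm_lt_one {E : Type*} [NormedAddCommGroup E] {x ζ : E} (hx : ‖x‖ < 1) (hζ : ‖ζ‖ = 1) : 0 < ‖ζ - x‖ := by
  have := norm_sub_norm_le ζ x
  linarith

variable {E : Type*} [NormedAddCommGroup E] [InnerProductSpace ℝ E]

/-- The second endpoint of the chord of the unit sphere through `ζ` and the interior point `x`. -/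
noncomputable def chordMap (x ζ : E) : E := x - ((1 - ‖x‖ ^ 2) / ‖ζ - x‖ ^ 2) • (ζ - x)

theorem chordMap_sub (x ζ : E) :
    chordMap x ζ - x = -((1 - ‖x‖ ^ 2) / ‖ζ - x‖ ^ 2) • (ζ - x) := by
  rw [chordMap]; module

theorem norm_chordMap_sub {x ζ : E} (hx : ‖x‖ < 1) (hζ : ‖ζ‖ = 1) :
    ‖chordMap x ζ - x‖ = (1 - ‖x‖ ^ 2) / ‖ζ - x‖ := by
  have h1 := one_sub_norm_sq_pos hx
  have h2 := norm_sub_pos_of_norm_lt_one hx hζ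
  rw [chordMap_sub, norm_smul, norm_neg, Real.norm_of_nonneg (by positivity)]
  field_simp

/-- Power of a point: the two segments of a chord through `x` have lengths with product `1 - |x|²`,
and the scalar in `chordMap` is chosen accordingly. -/
theorem norm_chordMap {x ζ : E} (hx : ‖x‖ < 1) (hζ : ‖ζ‖ = 1) : ‖chordMap x ζ‖ = 1 := by
  have h2 := norm_sub_pos_of_norm_lt_one hx hζ
  have h3 : ‖ζ - x‖ ^ 2 = 1 - 2 * inner ℝ ζ x + ‖x‖ ^ 2 := by
    rw [norm_sub_sq_real, hζ, one_pow]
  have h4 : inner ℝ x (ζ - x) = inner ℝ ζ x - ‖x‖ ^ 2 := by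
    rw [inner_sub_right, real_inner_self_eq_norm_sq, real_inner_comm]
  have : ‖chordMap x ζ‖ ^ 2 = 1 := by
    rw [chordMap, norm_sub_sq_real, inner_smul_right, norm_smul, h4, Real.norm_eq_abs, mul_pow,
      sq_abs]
    have h5 : inner ℝ ζ x = (1 + ‖x‖ ^ 2 - ‖ζ - x‖ ^ 2) / 2 := by linarith
    rw [h5]
    field_simp
    ring
  exact (pow_eq_one_iff_of_nonneg (norm_nonneg _) two_ne_zero).1 this

theorem chordMap_chordMap {x ζ : E} (hx : ‖x‖ < 1) (hζ : ‖ζ‖ = 1) :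
    chordMap x (chordMap x ζ) = ζ := by
  have h1 := one_sub_norm_sq_pos hx
  have h2 := norm_sub_pos_of_norm_lt_one hx hζ
  rw [chordMap, norm_chordMap_sub hx hζ, chordMap_sub, smul_smul]
  have : (1 - ‖x‖ ^ 2) / ((1 - ‖x‖ ^ 2) / ‖ζ - x‖) ^ 2 * -((1 - ‖x‖ ^ 2) / ‖ζ - x‖ ^ 2) = -1 := by
    field_simp
  rw [this]
  module

/-- The extension of `chordMap x` from the unit sphere, homogeneous of degree one. -/
noncomputable def chordExt (x y : E) : E := ‖y‖ • chordMap x (‖y‖⁻¹ • y)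

theorem norm_inv_norm_smul {y : E} (hy : y ≠ 0) : ‖‖y‖⁻¹ • y‖ = 1 := by
  rw [norm_smul, norm_inv, norm_norm, inv_mul_cancel₀ (norm_ne_zero_iff.2 hy)]

theorem norm_chordExt {x y : E} (hx : ‖x‖ < 1) (hy : y ≠ 0) : ‖chordExt x y‖ = ‖y‖ := by
  rw [chordExt, norm_smul, norm_norm, norm_chordMap hx (norm_inv_norm_smul hy), mul_one]

theorem inv_norm_smul_chordExt {x y : E} (hx : ‖x‖ < 1) (hy : y ≠ 0) :
    ‖chordExt x y‖⁻¹ • chordExt x y = chordMap x (‖y‖⁻¹ • y) := by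
  rw [norm_chordExt hx hy, chordExt, smul_smul, inv_mul_cancel₀ (norm_ne_zero_iff.2 hy), one_smul]

theorem chordExt_chordExt {x y : E} (hx : ‖x‖ < 1) (hy : y ≠ 0) :
    chordExt x (chordExt x y) = y := by
  rw [chordExt, inv_norm_smul_chordExt hx hy, chordMap_chordMap hx (norm_inv_norm_smul hy),
    norm_chordExt hx hy, smul_smul, mul_inv_cancel₀ (norm_ne_zero_iff.2 hy), one_smul]

/-- A form free of the normalized vector `y / |y|`, convenient for the product rule; the scalar is
`chordFactor x y`. -/
theorem chordExt_eq {x y : E} (hy : y ≠ 0) :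
    chordExt x y = ‖y‖ • x -
      ((1 - ‖x‖ ^ 2) * ‖y‖ ^ 2 * (‖y - ‖y‖ • x‖ ^ 2)⁻¹) • (y - ‖y‖ • x) := by
  have hy' : ‖y‖ ≠ 0 := norm_ne_zero_iff.2 hy
  have h : ‖y‖⁻¹ • y - x = ‖y‖⁻¹ • (y - ‖y‖ • x) := by
    rw [smul_sub, smul_smul, inv_mul_cancel₀ hy', one_smul]
  rw [chordExt, chordMap, h, norm_smul, norm_inv, norm_norm, smul_sub, smul_smul, smul_smul]
  congr 2
  field_simp

theorem hasFDerivAt_norm_of_ne_zero {y : E} (hy : y ≠ 0) :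
    HasFDerivAt (fun y : E => ‖y‖) (‖y‖⁻¹ • innerSL ℝ y) y := by
  have hy' : ‖y‖ ≠ 0 := norm_ne_zero_iff.2 hy
  have h := (HasFDerivAt.norm_sq (hasFDerivAt_id (𝕜 := ℝ) y)).sqrt (by simpa using hy)
  simp only [id, Real.sqrt_sq (norm_nonneg _)] at h
  convert h using 1
  ext v
  simp
  field_simp

/-- The conformal factor of `chordExt`. -/
noncomputable def chordFactor (x y : E) : ℝ := (1 - ‖x‖ ^ 2) * ‖y‖ ^ 2 * (‖y - ‖y‖ • x‖ ^ 2)⁻¹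

theorem norm_sub_norm_smul_pos {x y : E} (hx : ‖x‖ < 1) (hy : y ≠ 0) : 0 < ‖y - ‖y‖ • x‖ := by
  have h0 : 0 < ‖y‖ := norm_pos_iff.2 hy
  have h := norm_sub_norm_le y (‖y‖ • x)
  rw [norm_smul, norm_norm] at h
  nlinarith

theorem chordFactor_pos {x y : E} (hx : ‖x‖ < 1) (hy : y ≠ 0) : 0 < chordFactor x y := by
  have h0 : 0 < ‖y‖ := norm_pos_iff.2 hy
  have h1 := one_sub_norm_sq_pos hx
  have h2 := norm_sub_norm_smul_pos hx hy
  rw [chordFactor]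
  positivity

theorem chordFactor_eq {x y : E} (hy : y ≠ 0) :
    chordFactor x y = (1 - ‖x‖ ^ 2) / ‖‖y‖⁻¹ • y - x‖ ^ 2 := by
  have hy' : ‖y‖ ≠ 0 := norm_ne_zero_iff.2 hy
  have h : ‖y‖⁻¹ • y - x = ‖y‖⁻¹ • (y - ‖y‖ • x) := by
    rw [smul_sub, smul_smul, inv_mul_cancel₀ hy', one_smul]
  rw [chordFactor, h, norm_smul, norm_inv, norm_norm]
  field_simp

/-- The derivative of `chordExt x` at `y`: a dilation with factor `chordFactor x y` on the
orthogonal complement of `y`, an isometry along `y`, followed by a reflection. -/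
noncomputable def chordDeriv (x y : E) : E →L[ℝ] E :=
  ((ℝ ∙ (y - ‖y‖ • x)).reflection.toContinuousLinearEquiv : E →L[ℝ] E) ∘L
    (chordFactor x y • (ContinuousLinearMap.id ℝ E +
      (innerSL ℝ (-((1 + chordFactor x y) / chordFactor x y / ‖y‖ ^ 2) • y)).smulRight y))

theorem chordDeriv_apply {x y : E} (hx : ‖x‖ < 1) (hy : y ≠ 0) (h : E) :
    chordDeriv x y h = chordFactor x y •
      ((2 * inner ℝ (y - ‖y‖ • x) h / ‖y - ‖y‖ • x‖ ^ 2) • (y - ‖y‖ • x) - h) -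
      ((1 + chordFactor x y) * (inner ℝ y h / ‖y‖)) •
        ((chordFactor x y / ‖y‖) • (y - ‖y‖ • x) - x) := by
  have h0 : 0 < ‖y‖ := norm_pos_iff.2 hy
  have hw := norm_sub_norm_smul_pos hx hy
  have hl := chordFactor_pos hx hy
  set w := y - ‖y‖ • x with hwdef
  set l := chordFactor x y with hldef
  -- This identity determines the reflection of `y` in the line of `w`: it is `(1 + l) w - y`, which
  -- is also `chordExt x y` up to sign.
  have hwy : 2 * inner ℝ w y = ‖w‖ ^ 2 * (1 + l) := by
    have e1 : ‖w‖ ^ 2 = ‖y‖ ^ 2 - 2 * ‖y‖ * inner ℝ x y + ‖y‖ ^ 2 * ‖x‖ ^ 2 := by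
      rw [hwdef, norm_sub_sq_real, inner_smul_right, norm_smul, norm_norm, real_inner_comm]
      ring
    have e2 : inner ℝ w y = ‖y‖ ^ 2 - ‖y‖ * inner ℝ x y := by
      rw [hwdef, inner_sub_left, inner_smul_left, real_inner_self_eq_norm_sq]; simp
    have e3 : ‖w‖ ^ 2 * l = (1 - ‖x‖ ^ 2) * ‖y‖ ^ 2 := by
      rw [hldef, chordFactor, ← hwdef]; field_simp
    rw [mul_add, e3, e1, e2]; ring
  have hR : ∀ v, (ℝ ∙ w).reflection v = (2 * inner ℝ w v / ‖w‖ ^ 2) • w - v := by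
    intro v
    rw [Submodule.reflection_singleton_apply]
    simp only [RCLike.ofReal_real_eq_id, id]
    module
  have hRy : (ℝ ∙ w).reflection y = (1 + l) • w - y := by
    rw [hR, hwy]; congr 2; field_simp
  have hyw : y = w + ‖y‖ • x := by rw [hwdef]; abel
  change (ℝ ∙ w).reflection (l • (h + inner ℝ (-((1 + l) / l / ‖y‖ ^ 2) • y) h • y)) = _
  simp only [map_smul, map_add, hRy, hR h, inner_smul_left]
  have hy2 : (1 + l) • w - y = l • w - ‖y‖ • x := by
    nth_rewrite 1 [hyw]; module
  rw [hy2]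
  simp only [conj_trivial]
  clear_value w l
  match_scalars
  · field_simp
    ring
  · field_simp
  · field_simp

theorem hasFDerivAt_chordExt {x y : E} (hx : ‖x‖ < 1) (hy : y ≠ 0) :
    HasFDerivAt (chordExt x) (chordDeriv x y) y := by
  have h0 : 0 < ‖y‖ := norm_pos_iff.2 hy
  have hw := norm_sub_norm_smul_pos hx hy
  have hev : chordExt x =ᶠ[nhds y] fun y => ‖y‖ • x -
      ((1 - ‖x‖ ^ 2) * ‖y‖ ^ 2 * (‖y - ‖y‖ • x‖ ^ 2)⁻¹) • (y - ‖y‖ • x) := by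
    filter_upwards [isOpen_ne.mem_nhds hy] with z hz using chordExt_eq hz
  refine HasFDerivAt.congr_of_eventuallyEq ?_ hev
  have hN := hasFDerivAt_norm_of_ne_zero hy
  have hW : HasFDerivAt (fun y : E => y - ‖y‖ • x) _ y :=
    (hasFDerivAt_id y).sub (hN.smul_const x)
  have hinv : HasFDerivAt (fun y : E => (‖y - ‖y‖ • x‖ ^ 2)⁻¹) _ y :=
    (hasDerivAt_inv (by positivity)).comp_hasFDerivAt y hW.norm_sq
  have hmain := (hN.smul_const x).sub ((((hN.pow 2).const_mul (1 - ‖x‖ ^ 2)).mul hinv).smul hW)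
  refine hmain.congr_fderiv ?_
  ext1 h
  rw [chordDeriv_apply hx hy]
  have hwx : 2 * inner ℝ (y - ‖y‖ • x) x * ‖y‖ =
      ‖y - ‖y‖ • x‖ ^ 2 * (chordFactor x y - 1) := by
    have e1 : ‖y - ‖y‖ • x‖ ^ 2 = ‖y‖ ^ 2 - 2 * ‖y‖ * inner ℝ y x + ‖y‖ ^ 2 * ‖x‖ ^ 2 := by
      rw [norm_sub_sq_real, inner_smul_right, norm_smul, norm_norm]
      ring
    have e2 : inner ℝ (y - ‖y‖ • x) x = inner ℝ y x - ‖y‖ * ‖x‖ ^ 2 := by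
      rw [inner_sub_left, inner_smul_left, real_inner_self_eq_norm_sq]; simp
    have e3 : ‖y - ‖y‖ • x‖ ^ 2 * chordFactor x y = (1 - ‖x‖ ^ 2) * ‖y‖ ^ 2 := by
      rw [chordFactor]; field_simp
    rw [mul_sub, e3, e1, e2]; ring
  have e3 : (1 - ‖x‖ ^ 2) = ‖y - ‖y‖ • x‖ ^ 2 * chordFactor x y / ‖y‖ ^ 2 := by
    rw [chordFactor]; field_simp
  rw [e3]
  have hwx' : inner ℝ (y - ‖y‖ • x) x =
      ‖y - ‖y‖ • x‖ ^ 2 * (chordFactor x y - 1) / (2 * ‖y‖) := by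
    rw [← hwx]; field_simp
  clear hmain hinv hW hN hev hwx e3
  simp only [Pi.mul_apply]
  generalize chordFactor x y = l at *
  generalize y - ‖y‖ • x = w at *
  simp [hwx']
  match_scalars
  · field_simp
    ring
  · field_simp
  · field_simp
    ring

/-- With `λ = chordFactor x y` the transvection has determinant `-1/λ`; scaling by `λ` in dimension
`d` leaves `-λ^(d-1)`, and the reflection changes only the sign. The missing power of `λ` reflects
that `chordExt x` preserves the norm. -/
theorem abs_det_chordDeriv [FiniteDimensional ℝ E] [Nontrivial E] {x y : E} (hx : ‖x‖ < 1)
    (hy : y ≠ 0) :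
    |(chordDeriv x y).det| = chordFactor x y ^ (Module.finrank ℝ E - 1) := by
  have hl := chordFactor_pos hx hy
  have h0 : 0 < ‖y‖ := norm_pos_iff.2 hy
  set f : Module.Dual ℝ E :=
    (innerSL ℝ (-((1 + chordFactor x y) / chordFactor x y / ‖y‖ ^ 2) • y)).toLinearMap with hf
  have h1 : ((chordDeriv x y : E →L[ℝ] E) : E →ₗ[ℝ] E) =
      ((ℝ ∙ (y - ‖y‖ • x)).reflection.toLinearMap) ∘ₗ
        (chordFactor x y • LinearMap.transvection f y) := by
    ext h
    rfl
  have hfy : f y = -((1 + chordFactor x y) / chordFactor x y) := by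
    have : f y = inner ℝ (-((1 + chordFactor x y) / chordFactor x y / ‖y‖ ^ 2) • y) y := rfl
    rw [this, inner_smul_left, real_inner_self_eq_norm_sq, conj_trivial]
    field_simp
  have hd : 0 < Module.finrank ℝ E := Module.finrank_pos
  rw [ContinuousLinearMap.det, h1, LinearMap.det_comp, LinearMap.det_smul,
    LinearMap.transvection.det, hfy, Submodule.det_reflection, abs_mul, abs_pow, abs_neg, abs_one,
    one_pow, one_mul, abs_mul, abs_pow, abs_of_pos hl]
  have : 1 + -((1 + chordFactor x y) / chordFactor x y) = -(chordFactor x y)⁻¹ := by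
    field_simp; ring
  rw [this, abs_neg, abs_inv, abs_of_pos hl]
  obtain ⟨d, hd'⟩ := Nat.exists_eq_succ_of_ne_zero hd.ne'
  rw [hd', Nat.succ_sub_one, pow_succ]
  field_simp

/-- `chordExt x` is a norm-preserving involution of the punctured ball, so the Jacobian formula
there descends to the sphere. -/
theorem integral_sigma_chordMap {n : ℕ} [NeZero n] {x : EuclideanSpace ℝ (Fin n)} (hx : ‖x‖ < 1)
    (g : EuclideanSpace ℝ (Fin n) → ℝ) :
    ∫ ζ : Sph n, ((1 - ‖x‖ ^ 2) / ‖(ζ : EuclideanSpace ℝ (Fin n)) - x‖ ^ 2) ^ (n - 1) *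
      g (chordMap x ζ) ∂sigma n = ∫ ζ : Sph n, g ζ ∂sigma n := by
  rw [integral_sigma_eq_integral_ball g, integral_sigma_eq_integral_ball
    (fun ζ => ((1 - ‖x‖ ^ 2) / ‖ζ - x‖ ^ 2) ^ (n - 1) * g (chordMap x ζ))]
  congr 1
  -- The origin is discarded because the derivative formula for `chordExt x` holds only away from
  -- it.
  have hU : ∀ F : EuclideanSpace ℝ (Fin n) → ℝ, ∫ y in ball 0 1, F y = ∫ y in ball 0 1 \ {0}, F y :=
    fun F => setIntegral_congr_set (sdiff_null_ae_eq_self (measure_singleton _)).symm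
  have himg : chordExt x '' (ball 0 1 \ {0}) = ball (0 : EuclideanSpace ℝ (Fin n)) 1 \ {0} := by
    have hmaps : ∀ y ∈ ball (0 : EuclideanSpace ℝ (Fin n)) 1 \ {0},
        chordExt x y ∈ ball (0 : EuclideanSpace ℝ (Fin n)) 1 \ {0} := by
      rintro y ⟨hy1, hy0⟩
      rw [mem_ball_zero_iff] at hy1
      refine ⟨?_, ?_⟩
      · rw [mem_ball_zero_iff, norm_chordExt hx hy0]; exact hy1
      · rw [Set.mem_singleton_iff, ← norm_eq_zero, norm_chordExt hx hy0, norm_eq_zero]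
        exact hy0
    refine Set.Subset.antisymm (Set.image_subset_iff.2 hmaps) fun y hy => ?_
    exact ⟨chordExt x y, hmaps y hy, chordExt_chordExt hx hy.2⟩
  have h := integral_image_eq_integral_abs_det_fderiv_smul volume
    (s := ball (0 : EuclideanSpace ℝ (Fin n)) 1 \ {0})
    (measurableSet_ball.diff (measurableSet_singleton _))
    (fun y hy => (hasFDerivAt_chordExt hx hy.2).hasFDerivWithinAt)
    (fun y hy z hz hyz => by
      rw [← chordExt_chordExt hx hy.2, hyz, chordExt_chordExt hx hz.2])
    (fun y => g (‖y‖⁻¹ • y))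
  rw [hU, hU, ← himg, h, himg]
  refine setIntegral_congr_fun (measurableSet_ball.diff (measurableSet_singleton _)) fun y hy => ?_
  simp only [smul_eq_mul]
  rw [abs_det_chordDeriv hx hy.2, finrank_euclideanSpace_fin, inv_norm_smul_chordExt hx hy.2,
    chordFactor_eq hy.2]

end Chord

/-! ### Pochhammer identities and a quadratic transformation of `₂F₁`. -/

section Hypergeometric

theorem choose_eq_ascPochhammer (a : ℝ) (k : ℕ) :
    Ring.choose a k = (ascPochhammer ℝ k).eval (a - k + 1) / k.factorial := by
  simp only [Ring.choose_eq_smul, Polynomial.descPochhammer_smeval_eq_ascPochhammer,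
    Polynomial.ascPochhammer_smeval_cast, Polynomial.ascPochhammer_smeval_eq_eval,
    smul_eq_mul]
  ring

theorem choose_eq_ascPochhammer_neg (a : ℝ) (k : ℕ) :
    Ring.choose a k = (-1) ^ k * (ascPochhammer ℝ k).eval (-a) / k.factorial := by
  rw [choose_eq_ascPochhammer, ascPochhammer_eval_neg_eq_descPochhammer,
    descPochhammer_eval_eq_ascPochhammer, ← mul_assoc, ← mul_pow]
  simp

theorem ascPochhammer_eval_add (x : ℝ) (k i : ℕ) :
    (ascPochhammer ℝ (k + i)).eval x =
      (ascPochhammer ℝ k).eval x * (ascPochhammer ℝ i).eval (x + k) := by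
  rw [← ascPochhammer_mul]
  simp

theorem ascPochhammer_eval_two_mul (x : ℝ) (k : ℕ) :
    (ascPochhammer ℝ (2 * k)).eval x =
      4 ^ k * (ascPochhammer ℝ k).eval (x / 2) * (ascPochhammer ℝ k).eval ((1 + x) / 2) := by
  induction k with
  | zero => simp
  | succ k ih =>
    rw [show 2 * (k + 1) = 2 * k + 1 + 1 by ring, ascPochhammer_succ_eval, ascPochhammer_succ_eval,
      ih, ascPochhammer_succ_eval, ascPochhammer_succ_eval]
    push_cast
    ring

theorem factorial_two_mul (k : ℕ) :
    ((2 * k).factorial : ℝ) = 4 ^ k * k.factorial * (ascPochhammer ℝ k).eval (1 / 2) := by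
  have h := ascPochhammer_eval_two_mul 1 k
  norm_num at h
  rw [h]; norm_num; ring

theorem choose_two_mul (a : ℝ) (k : ℕ) :
    Ring.choose a (2 * k) = (ascPochhammer ℝ k).eval (-a / 2) *
      (ascPochhammer ℝ k).eval ((1 - a) / 2) /
        ((ascPochhammer ℝ k).eval (1 / 2) * k.factorial) := by
  have h1 : (0 : ℝ) < (ascPochhammer ℝ k).eval (1 / 2) := ascPochhammer_pos _ _ (by norm_num)
  have h2 : (0 : ℝ) < k.factorial := by positivity
  rw [choose_eq_ascPochhammer_neg, factorial_two_mul, ascPochhammer_eval_two_mul,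
    show (1 + -a) / 2 = (1 - a) / 2 by ring, pow_mul]
  field_simp
  norm_num

/-- The coefficient of `s^m` in the quadratic transformation. Up to a factor depending only on `m`,
the summand is `choose (a - m) k * choose (c + m - 1) i`, and the Chu–Vandermonde identity sums it
to `choose (a + c - 1) m`. -/
theorem sum_antidiagonal_quadratic (a : ℝ) {c : ℝ} (hc : 0 < c) (m : ℕ) :
    ∑ p ∈ Finset.HasAntidiagonal.antidiagonal m,
      (ascPochhammer ℝ p.1).eval (-a / 2) * (ascPochhammer ℝ p.1).eval ((1 - a) / 2) /
        ((p.1.factorial : ℝ) * (ascPochhammer ℝ p.1).eval c) * 4 ^ p.1 *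
        Ring.choose (a - 2 * p.1) p.2 =
      (ascPochhammer ℝ m).eval (-a) * (ascPochhammer ℝ m).eval (1 - a - c) /
        (m.factorial * (ascPochhammer ℝ m).eval c) := by
  have hm : (0 : ℝ) < (ascPochhammer ℝ m).eval c := ascPochhammer_pos _ _ hc
  have hV := Ring.add_choose_eq m (Commute.all (a - m) (c + m - 1))
  have hterm : ∀ p ∈ Finset.HasAntidiagonal.antidiagonal m,
      (ascPochhammer ℝ p.1).eval (-a / 2) * (ascPochhammer ℝ p.1).eval ((1 - a) / 2) /
        ((p.1.factorial : ℝ) * (ascPochhammer ℝ p.1).eval c) * 4 ^ p.1 *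
        Ring.choose (a - 2 * p.1) p.2 =
      (-1) ^ m * (ascPochhammer ℝ m).eval (-a) / (ascPochhammer ℝ m).eval c *
        (Ring.choose (a - m) p.1 * Ring.choose (c + m - 1) p.2) := by
    rintro ⟨k, i⟩ hp
    rw [Finset.HasAntidiagonal.mem_antidiagonal] at hp
    simp only at hp ⊢
    have h1 : (0 : ℝ) < (ascPochhammer ℝ k).eval c := ascPochhammer_pos _ _ hc
    have hci : (0 : ℝ) < (ascPochhammer ℝ i).eval (c + k) := ascPochhammer_pos _ _ (by positivity)
    have e1 : (ascPochhammer ℝ (2 * k)).eval (-a) * (ascPochhammer ℝ i).eval (-a + 2 * k) =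
        (ascPochhammer ℝ m).eval (-a) * (ascPochhammer ℝ k).eval (-a + m) := by
      have := ascPochhammer_eval_add (-a) (2 * k) i
      push_cast at this
      rw [← this, ← ascPochhammer_eval_add, ← hp]
      congr 2; ring
    have e2 : (ascPochhammer ℝ m).eval c =
        (ascPochhammer ℝ k).eval c * (ascPochhammer ℝ i).eval (c + k) := by
      rw [← hp, ascPochhammer_eval_add]
    rw [choose_eq_ascPochhammer (c + m - 1) i, choose_eq_ascPochhammer_neg (a - m) k,
      choose_eq_ascPochhammer_neg _ i, e2]
    have e3 : c + m - 1 - i + 1 = c + k := by rw [← hp]; push_cast; ring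
    have e4 : -(a - 2 * (k : ℝ)) = -a + 2 * k := by ring
    have e5 : -(a - (m : ℝ)) = -a + m := by ring
    rw [e3, e4, e5]
    rw [ascPochhammer_eval_two_mul, show (1 + -a) / 2 = (1 - a) / 2 by ring] at e1
    have e6 : ((-1 : ℝ)) ^ m * (-1) ^ k = (-1) ^ i := by
      rw [← hp, pow_add, mul_right_comm, ← mul_pow]; simp
    rw [neg_div] at *
    field_simp
    rw [← e6]
    linear_combination ((-1 : ℝ)) ^ m * (-1) ^ k * e1
  rw [Finset.sum_congr rfl hterm, ← Finset.mul_sum, ← hV,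
    show a - m + (c + m - 1) = a + c - 1 by ring, choose_eq_ascPochhammer_neg,
    show -(a + c - 1) = 1 - a - c by ring]
  have e6 : ((-1 : ℝ)) ^ m * (-1) ^ m = 1 := by rw [← mul_pow]; simp
  field_simp
  linear_combination (ascPochhammer ℝ m).eval (-a) * (ascPochhammer ℝ m).eval (1 - a - c) * e6

/-- The radius is `1` unless a parameter is a nonpositive integer; then the series terminates (for
`c`, because division by zero gives `0`) and the radius is infinite. -/
theorem one_le_radius_ordinaryHypergeometricSeries (a b c : ℝ) :
    1 ≤ (ordinaryHypergeometricSeries ℝ a b c).radius := by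
  by_cases h : ∀ k : ℕ, (k : ℝ) ≠ -a ∧ (k : ℝ) ≠ -b ∧ (k : ℝ) ≠ -c
  · rw [ordinaryHypergeometricSeries_radius_eq_one ℝ a b c h]
  · push Not at h
    obtain ⟨k, hk⟩ := h
    have h3 : a = -(k : ℝ) ∨ b = -(k : ℝ) ∨ c = -(k : ℝ) := by
      by_cases h1 : (k : ℝ) = -a
      · left; linarith
      · by_cases h2 : (k : ℝ) = -b
        · right; left; linarith
        · right; right; linarith [hk h1 h2]
    rcases h3 with rfl | rfl | rfl
    · rw [ordinaryHypergeometric_radius_top_of_neg_nat₁]; exact le_top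
    · rw [ordinaryHypergeometric_radius_top_of_neg_nat₂]; exact le_top
    · rw [ordinaryHypergeometric_radius_top_of_neg_nat₃]; exact le_top

theorem mem_eball_radius_ordinaryHypergeometricSeries (a b c : ℝ) {z : ℝ} (hz : |z| < 1) :
    z ∈ eball (0 : ℝ) (ordinaryHypergeometricSeries ℝ a b c).radius := by
  have : z ∈ eball (0 : ℝ) 1 := by
    rw [← ENNReal.ofReal_one, eball_ofReal]; simpa using hz
  exact eball_subset_eball (one_le_radius_ordinaryHypergeometricSeries a b c) this

theorem summable_abs_ordinaryHypergeometricCoefficient (a b c : ℝ) {z : ℝ} (hz : |z| < 1) :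
    Summable fun k => |ordinaryHypergeometricCoefficient a b c k * z ^ k| := by
  have h := FormalMultilinearSeries.summable_norm_apply _
    (mem_eball_radius_ordinaryHypergeometricSeries a b c hz)
  simpa only [ordinaryHypergeometricSeries_apply_eq, smul_eq_mul, Real.norm_eq_abs] using h

theorem hasSum_ordinaryHypergeometric (a b c : ℝ) {z : ℝ} (hz : |z| < 1) :
    HasSum (fun k => ordinaryHypergeometricCoefficient a b c k * z ^ k)
      (ordinaryHypergeometric a b c z) := by
  rw [ordinaryHypergeometric_eq_tsum]
  simp only [smul_eq_mul]
  exact (summable_abs_ordinaryHypergeometricCoefficient a b c hz).of_abs.hasSum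

theorem analyticAt_ordinaryHypergeometric (a b c : ℝ) {z : ℝ} (hz : |z| < 1) :
    AnalyticAt ℝ (ordinaryHypergeometric a b c : ℝ → ℝ) z :=
  ((ordinaryHypergeometricSeries ℝ a b c).hasFPowerSeriesOnBall
    (zero_lt_one.trans_le (one_le_radius_ordinaryHypergeometricSeries a b c))).analyticAt_of_mem
    (mem_eball_radius_ordinaryHypergeometricSeries a b c hz)

theorem hasSum_one_add_rpow (a : ℝ) {z : ℝ} (hz : |z| < 1) :
    HasSum (fun k => Ring.choose a k * z ^ k) ((1 + z) ^ a) := by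
  have h := (Real.one_add_rpow_hasFPowerSeriesOnBall_zero (a := a)).hasSum (y := z) (by
    rw [← ENNReal.ofReal_one, eball_ofReal]; simpa using hz)
  simpa [binomialSeries_apply, -FormalMultilinearSeries.apply_eq_prod_smul_coeff] using h

theorem summable_abs_choose (a : ℝ) {z : ℝ} (hz : |z| < 1) :
    Summable fun k => |Ring.choose a k * z ^ k| := by
  have h := FormalMultilinearSeries.summable_norm_apply (binomialSeries ℝ a) (x := z)
    (eball_subset_eball binomialSeries_radius_ge_one (by
      rw [← ENNReal.ofReal_one, eball_ofReal]; simpa using hz))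
  simpa [binomialSeries_apply, -FormalMultilinearSeries.apply_eq_prod_smul_coeff] using h

theorem abs_ascPochhammer_eval_le {x y : ℝ} (h : |x| ≤ y) (k : ℕ) :
    |(ascPochhammer ℝ k).eval x| ≤ (ascPochhammer ℝ k).eval y := by
  induction k with
  | zero => simp
  | succ k ih =>
    rw [ascPochhammer_succ_eval, ascPochhammer_succ_eval, abs_mul]
    have h0 := (abs_nonneg x).trans h
    refine mul_le_mul ih ?_ (abs_nonneg _) ((abs_nonneg _).trans ih)
    refine (abs_add_le _ _).trans ?_
    rw [abs_of_nonneg (Nat.cast_nonneg (α := ℝ) k)]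
    linarith

/-- The right side is the `i`-th coefficient of `(1 - t)^(-β)`, a series with nonnegative terms that
serves as a majorant. -/
theorem abs_choose_le {b β : ℝ} (h : |b| ≤ β) (i : ℕ) :
    |Ring.choose b i| ≤ (-1) ^ i * Ring.choose (-β) i := by
  rw [choose_eq_ascPochhammer_neg, choose_eq_ascPochhammer_neg, abs_div, abs_mul, abs_pow, abs_neg,
    abs_one, one_pow, one_mul, neg_neg, mul_div_assoc, ← mul_assoc, ← mul_pow, Nat.abs_cast]
  norm_num
  have := abs_ascPochhammer_eval_le (x := -b) (y := β) (by rwa [abs_neg]) i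
  gcongr

/-- Each `(1 + s)^(a - 2k)` is expanded by the binomial series and the double series is regrouped
along antidiagonals. The majorant needs `4|s| / (1 - |s|)² < 1`, that is `|s| < 3 - 2√2`, and `1/10`
is below this. -/
theorem quadratic_transformation_of_abs_le (a : ℝ) {c : ℝ} (hc : 0 < c) {s : ℝ}
    (hs : |s| ≤ 1 / 10) :
    (1 + s) ^ a * ordinaryHypergeometric (-a / 2) ((1 - a) / 2) c (4 * s / (1 + s) ^ 2) =
      ordinaryHypergeometric (-a) (1 - a - c) c s := by
  have hs1 : |s| < 1 := by linarith
  have hs' := abs_le.1 hs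
  have h1s : 0 < 1 + s := by linarith
  set A : ℕ → ℝ := fun k => ordinaryHypergeometricCoefficient (-a / 2) ((1 - a) / 2) c k with hA
  let T : ℕ × ℕ → ℝ := fun p => A p.1 * (4 * s) ^ p.1 * (Ring.choose (a - 2 * p.1) p.2 * s ^ p.2)
  have hinner : ∀ k : ℕ, HasSum (fun i => T (k, i)) (A k * (4 * s) ^ k * (1 + s) ^ (a - 2 * k)) :=
    fun k => (hasSum_one_add_rpow (a - 2 * k) hs1).mul_left _
  have habs : ∀ k : ℕ, ∀ i, |T (k, i)| ≤ |A k * (4 * s) ^ k| *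
      (Ring.choose (-(|a| + 2 * k)) i * (-|s|) ^ i) := by
    intro k i
    have h1 : |a - 2 * (k : ℝ)| ≤ |a| + 2 * k := by
      refine (abs_sub _ _).trans ?_
      rw [abs_of_nonneg (by positivity : (0 : ℝ) ≤ 2 * k)]
    have h2 := abs_choose_le h1 i
    simp only [T]
    rw [abs_mul, abs_mul (Ring.choose _ _), abs_pow s, neg_pow |s|]
    refine mul_le_mul_of_nonneg_left ?_ (abs_nonneg _)
    rw [← mul_assoc]
    refine mul_le_mul_of_nonneg_right ?_ (by positivity)
    rw [mul_comm (Ring.choose _ _)]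
    exact h2
  have hmaj : ∀ k : ℕ, HasSum (fun i => |A k * (4 * s) ^ k| *
      (Ring.choose (-(|a| + 2 * k)) i * (-|s|) ^ i))
      (|A k * (4 * s) ^ k| * (1 + -|s|) ^ (-(|a| + 2 * k))) := fun k =>
    (hasSum_one_add_rpow _ (by rwa [abs_neg, abs_abs])).mul_left _
  have hsum : Summable T := by
    refine Summable.of_abs ((summable_prod_of_nonneg fun p => abs_nonneg _).2 ⟨fun k => ?_, ?_⟩)
    · exact (hmaj k).summable.of_nonneg_of_le (fun i => abs_nonneg _) (habs k)
    · have h0 : 0 < 1 + -|s| := by linarith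
      have hz : |4 * |s| / (1 + -|s|) ^ 2| < 1 := by
        rw [abs_of_nonneg (by positivity), div_lt_one (by positivity)]
        nlinarith [abs_nonneg s]
      refine Summable.of_nonneg_of_le (fun k => tsum_nonneg fun i => abs_nonneg _) (fun k => ?_)
        ((summable_abs_ordinaryHypergeometricCoefficient (-a / 2) ((1 - a) / 2) c hz).mul_left
          ((1 + -|s|) ^ (-|a|)))
      refine (((hmaj k).summable.of_nonneg_of_le (fun i => abs_nonneg _) (habs k)).tsum_le_tsum
        (habs k) (hmaj k).summable).trans (le_of_eq ?_)
      rw [(hmaj k).tsum_eq]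
      change _ = (1 + -|s|) ^ (-|a|) * |A k * (4 * |s| / (1 + -|s|) ^ 2) ^ k|
      rw [show -(|a| + 2 * (k : ℝ)) = -|a| + -((2 * k : ℕ) : ℝ) by push_cast; ring,
        Real.rpow_add h0, Real.rpow_neg h0.le ((2 * k : ℕ) : ℝ), Real.rpow_natCast, abs_mul,
        abs_mul (A k), abs_pow (4 * s), abs_mul 4 s,
        abs_of_nonneg (by positivity : 0 ≤ (4 * |s| / (1 + -|s|) ^ 2) ^ k), div_pow, ← pow_mul,
        abs_of_pos (by norm_num : (0 : ℝ) < 4)]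
      field_simp
  have hz : |4 * s / (1 + s) ^ 2| < 1 := by
    rw [abs_div, abs_of_pos (by positivity : 0 < (1 + s) ^ 2), div_lt_one (by positivity), abs_mul,
      abs_of_pos (by norm_num : (0 : ℝ) < 4)]
    nlinarith
  have hL : HasSum T ((1 + s) ^ a *
      ordinaryHypergeometric (-a / 2) ((1 - a) / 2) c (4 * s / (1 + s) ^ 2)) := by
    have h := (hasSum_ordinaryHypergeometric (-a / 2) ((1 - a) / 2) c hz).mul_left ((1 + s) ^ a)
    have h2 : ∀ k : ℕ, (1 + s) ^ a * (A k * (4 * s / (1 + s) ^ 2) ^ k) =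
        A k * (4 * s) ^ k * (1 + s) ^ (a - 2 * k) := by
      intro k
      rw [show a - 2 * (k : ℝ) = a - ((2 * k : ℕ) : ℝ) by push_cast; ring, Real.rpow_sub h1s,
        Real.rpow_natCast, div_pow, ← pow_mul]
      ring
    have h3 := hsum.hasSum.prod_fiberwise hinner
    have h4 : (fun k => (1 + s) ^ a * (ordinaryHypergeometricCoefficient (-a / 2) ((1 - a) / 2) c k *
        (4 * s / (1 + s) ^ 2) ^ k)) = fun k => A k * (4 * s) ^ k * (1 + s) ^ (a - 2 * (k : ℝ)) :=
      funext h2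
    rw [h4] at h
    rw [h.unique h3]
    exact hsum.hasSum
  have hR := hasSum_ordinaryHypergeometric (-a) (1 - a - c) c hs1
  have hT := (Finset.HasAntidiagonal.sigmaAntidiagonalEquivProd.hasSum_iff.2 hL).sigma
    (fun m => hasSum_fintype _)
  refine hT.unique ?_
  convert hR using 2 with m
  have hm := sum_antidiagonal_quadratic a hc m
  refine (Finset.sum_attach (Finset.HasAntidiagonal.antidiagonal m) T).trans ?_
  have hT : ∀ p ∈ Finset.HasAntidiagonal.antidiagonal m, T p =
      (ascPochhammer ℝ p.1).eval (-a / 2) * (ascPochhammer ℝ p.1).eval ((1 - a) / 2) /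
        ((p.1.factorial : ℝ) * (ascPochhammer ℝ p.1).eval c) * 4 ^ p.1 *
        Ring.choose (a - 2 * p.1) p.2 * s ^ m := by
    intro p hp
    rw [Finset.HasAntidiagonal.mem_antidiagonal] at hp
    simp only [T, hA, ordinaryHypergeometricCoefficient]
    rw [← hp, pow_add, mul_pow]
    field_simp
  rw [Finset.sum_congr rfl hT, ← Finset.sum_mul, hm]
  congr 1
  rw [ordinaryHypergeometricCoefficient]
  field_simp

/-- Analytic continuation from a neighborhood of `0`: both sides are analytic on the interval, since
`|4s / (1 + s)²| < 1` there. -/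
theorem quadratic_transformation (a : ℝ) {c : ℝ} (hc : 0 < c) {s : ℝ}
    (hs : s ∈ Set.Ioo (-(1 / 10)) 1) :
    (1 + s) ^ a * ordinaryHypergeometric (-a / 2) ((1 - a) / 2) c (4 * s / (1 + s) ^ 2) =
      ordinaryHypergeometric (-a) (1 - a - c) c s := by
  have hf : AnalyticOnNhd ℝ (fun s : ℝ => (1 + s) ^ a *
      ordinaryHypergeometric (-a / 2) ((1 - a) / 2) c (4 * s / (1 + s) ^ 2))
      (Set.Ioo (-(1 / 10)) 1) := by
    rintro s ⟨hs1, hs2⟩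
    have h1s : 0 < 1 + s := by linarith
    have hz : |4 * s / (1 + s) ^ 2| < 1 := by
      rw [abs_div, abs_of_pos (by positivity : 0 < (1 + s) ^ 2), div_lt_one (by positivity), abs_lt]
      constructor <;> nlinarith
    have e1 : AnalyticAt ℝ (fun s : ℝ => (1 + s) ^ a) s :=
      ((Real.contDiffAt_rpow_const_of_ne (p := a) (n := ⊤) h1s.ne').analyticAt).comp
        (f := fun s : ℝ => 1 + s) (by fun_prop)
    have e2 : AnalyticAt ℝ (fun s : ℝ => 4 * s / (1 + s) ^ 2) s :=
      AnalyticAt.div (by fun_prop) (by fun_prop) (by positivity)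
    exact e1.mul ((analyticAt_ordinaryHypergeometric _ _ _ hz).comp
      (f := fun s : ℝ => 4 * s / (1 + s) ^ 2) e2)
  have hg : AnalyticOnNhd ℝ (ordinaryHypergeometric (-a) (1 - a - c) c : ℝ → ℝ)
      (Set.Ioo (-(1 / 10)) 1) := fun s hs =>
    analyticAt_ordinaryHypergeometric _ _ _ (abs_lt.2 ⟨by linarith [hs.1], hs.2⟩)
  refine hf.eqOn_of_preconnected_of_eventuallyEq hg isPreconnected_Ioo (z₀ := 0) (by norm_num) ?_ hs
  filter_upwards [Ioo_mem_nhds (show (-(1 / 10) : ℝ) < 0 by norm_num)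
    (show (0 : ℝ) < 1 / 10 by norm_num)] with s hs
  exact quadratic_transformation_of_abs_le a hc (abs_le.2 ⟨hs.1.le, hs.2.le⟩)

end Hypergeometric

/-! ### Which direction `l` maximizes the integral: rearrangement by reflections. -/

section Comparison

variable {n : ℕ}

theorem integrable_sigma_of_continuous [NeZero n] {f : Sph n → ℝ} (hf : Continuous f) :
    Integrable f (sigma n) :=
  hf.integrable_of_hasCompactSupport (HasCompactSupport.of_compactSpace f)

theorem norm_coe_sph (η : Sph n) : ‖(η : EuclideanSpace ℝ (Fin n))‖ = 1 := by
  simp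

theorem abs_inner_sph_le (η : Sph n) {e : EuclideanSpace ℝ (Fin n)} (he : ‖e‖ = 1) :
    |inner ℝ (η : EuclideanSpace ℝ (Fin n)) e| ≤ 1 := by
  have := abs_real_inner_le_norm (η : EuclideanSpace ℝ (Fin n)) e
  rwa [norm_coe_sph, he, one_mul] at this

/-- Averaging over `η` and `R η` turns the difference of the two integrals into half the integral of
the product in `hle`, so a pointwise sign condition is enough. -/
theorem integral_mul_le_of_swap [NeZero n] {R : EuclideanSpace ℝ (Fin n) ≃ₗᵢ[ℝ] EuclideanSpace ℝ (Fin n)}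
    (hR : ∀ y, R (R y) = y) {G h : ℝ → ℝ} {p v : EuclideanSpace ℝ (Fin n)}
    (hG : Continuous fun η : Sph n => G (inner ℝ (η : EuclideanSpace ℝ (Fin n)) p))
    (hG' : Continuous fun η : Sph n => G (inner ℝ (η : EuclideanSpace ℝ (Fin n)) (R p)))
    (hh : Continuous h)
    (hle : ∀ η : Sph n, (G (inner ℝ (η : EuclideanSpace ℝ (Fin n)) p) -
        G (inner ℝ (η : EuclideanSpace ℝ (Fin n)) (R p))) *
      (h (inner ℝ (η : EuclideanSpace ℝ (Fin n)) (R v)) -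
        h (inner ℝ (η : EuclideanSpace ℝ (Fin n)) v)) ≤ 0) :
    ∫ η : Sph n, G (inner ℝ (η : EuclideanSpace ℝ (Fin n)) p) *
        h (inner ℝ (η : EuclideanSpace ℝ (Fin n)) (R v)) ∂sigma n ≤
      ∫ η : Sph n, G (inner ℝ (η : EuclideanSpace ℝ (Fin n)) p) *
        h (inner ℝ (η : EuclideanSpace ℝ (Fin n)) v) ∂sigma n := by
  have hcont : ∀ w : EuclideanSpace ℝ (Fin n), Continuous fun η : Sph n =>
      h (inner ℝ (η : EuclideanSpace ℝ (Fin n)) w) := fun w => hh.comp (by fun_prop)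
  have hsym : ∀ y w, inner ℝ (R y) w = inner ℝ y (R w) := fun y w => by
    rw [← R.inner_map_map y (R w), hR]
  have i1 := integrable_sigma_of_continuous (hG.fun_mul (hcont (R v)))
  have i2 := integrable_sigma_of_continuous (hG.fun_mul (hcont v))
  have i3 := integrable_sigma_of_continuous (hG'.fun_mul (hcont (R v)))
  have i4 := integrable_sigma_of_continuous (hG'.fun_mul (hcont v))
  have e1 := integral_sigma_comp_isometry R (fun η => G (inner ℝ η p) * h (inner ℝ η (R v)))
  have e2 := integral_sigma_comp_isometry R (fun η => G (inner ℝ η p) * h (inner ℝ η v))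
  simp only [hsym, hR] at e1 e2
  have key : ∫ η : Sph n, ((G (inner ℝ (η : EuclideanSpace ℝ (Fin n)) p) *
        h (inner ℝ (η : EuclideanSpace ℝ (Fin n)) (R v)) +
      G (inner ℝ (η : EuclideanSpace ℝ (Fin n)) (R p)) *
        h (inner ℝ (η : EuclideanSpace ℝ (Fin n)) v))) ∂sigma n ≤
      ∫ η : Sph n, ((G (inner ℝ (η : EuclideanSpace ℝ (Fin n)) p) *
        h (inner ℝ (η : EuclideanSpace ℝ (Fin n)) v) +
      G (inner ℝ (η : EuclideanSpace ℝ (Fin n)) (R p)) *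
        h (inner ℝ (η : EuclideanSpace ℝ (Fin n)) (R v)))) ∂sigma n := by
    refine integral_mono (i1.add i4) (i2.add i3) fun η => ?_
    have := hle η
    simp only
    nlinarith
  rw [integral_add i1 i4, integral_add i2 i3, e1, e2] at key
  linarith

theorem integral_sigma_neg [NeZero n] (G : EuclideanSpace ℝ (Fin n) → ℝ) :
    ∫ η : Sph n, G (-η) ∂sigma n = ∫ η : Sph n, G η ∂sigma n :=
  integral_sigma_comp_isometry (LinearIsometryEquiv.neg ℝ) G

/-- `x^a = exp (a log x)`, where `a log x` is convex for `a ≤ 0` and `exp` is convex and increasing.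
-/
theorem convexOn_rpow_of_nonpos {a : ℝ} (ha : a ≤ 0) :
    ConvexOn ℝ (Set.Ioi 0) fun x : ℝ => x ^ a := by
  refine ⟨convex_Ioi 0, fun x hx y hy s t hs ht hst => ?_⟩
  have hx' : 0 < x := hx
  have hy' : 0 < y := hy
  have hxy : 0 < s • x + t • y := (convex_Ioi (0 : ℝ)) hx hy hs ht hst
  simp only [Real.rpow_def_of_pos hx', Real.rpow_def_of_pos hy', Real.rpow_def_of_pos hxy]
  have h1 := strictConcaveOn_log_Ioi.concaveOn.2 hx hy hs ht hst
  have h2 := convexOn_exp.2 (Set.mem_univ (Real.log x * a)) (Set.mem_univ (Real.log y * a)) hs ht hst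
  refine le_trans (Real.exp_le_exp.2 ?_) h2
  simp only [smul_eq_mul] at h1 ⊢
  nlinarith

/-- `D - s` and `D + s` are convex combinations of `D - t` and `D + t` with interchanged weights;
adding the two convexity inequalities gives the claim. -/
theorem _root_.ConvexOn.add_le_add_of_abs_le {f : ℝ → ℝ} (hf : ConvexOn ℝ (Set.Ioi 0) f)
    {D s t : ℝ} (hst : |s| ≤ t) (ht : t < D) :
    f (D - s) + f (D + s) ≤ f (D - t) + f (D + t) := by
  have hs := abs_le.1 hst
  rcases (abs_nonneg s).trans hst |>.eq_or_lt with h0 | h0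
  · have : s = 0 := by rw [← h0] at hst; exact abs_nonpos_iff.1 hst
    rw [this, ← h0]
  · have hm : D - t ∈ Set.Ioi (0 : ℝ) := by simp [ht]
    have hp : D + t ∈ Set.Ioi (0 : ℝ) := by simp only [Set.mem_Ioi]; linarith
    have h1 : 0 ≤ (t + s) / (2 * t) := div_nonneg (by linarith) (by linarith)
    have h2 : 0 ≤ (t - s) / (2 * t) := div_nonneg (by linarith) (by linarith)
    have h3 : (t + s) / (2 * t) + (t - s) / (2 * t) = 1 := by field_simp; ring
    have k1 := hf.2 hm hp h1 h2 h3
    have k2 := hf.2 hm hp h2 h1 (by rw [add_comm]; exact h3)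
    simp only [smul_eq_mul] at k1 k2
    have e1 : (t + s) / (2 * t) * (D - t) + (t - s) / (2 * t) * (D + t) = D - s := by
      field_simp; ring
    have e2 : (t - s) / (2 * t) * (D - t) + (t + s) / (2 * t) * (D + t) = D + s := by
      field_simp; ring
    rw [e1] at k1
    rw [e2] at k2
    have e3 : (t - s) / (2 * t) = 1 - (t + s) / (2 * t) := by linarith
    rw [e3] at k1 k2
    nlinarith

/-- The integral of `|η - x|^(2a) |⟨η, l⟩|^q` over the unit sphere. -/
noncomputable def rieszIntegral (a q : ℝ) (x l : EuclideanSpace ℝ (Fin n)) : ℝ :=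
  ∫ η : Sph n, ‖(η : EuclideanSpace ℝ (Fin n)) - x‖ ^ (2 * a) *
    |inner ℝ (η : EuclideanSpace ℝ (Fin n)) l| ^ q ∂sigma n

/-- Twice the even part of `t ↦ (1 + r² - 2rt)^a`. -/
noncomputable def evenKernel (a r t : ℝ) : ℝ :=
  (1 + r ^ 2 - 2 * r * t) ^ a + (1 + r ^ 2 + 2 * r * t) ^ a

theorem norm_sub_smul_rpow {η e : EuclideanSpace ℝ (Fin n)} (hη : ‖η‖ = 1) (he : ‖e‖ = 1)
    (r a : ℝ) : ‖η - r • e‖ ^ (2 * a) = (1 + r ^ 2 - 2 * r * inner ℝ η e) ^ a := by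
  rw [Real.rpow_mul (norm_nonneg _), Real.rpow_two, norm_sub_sq_real, inner_smul_right, norm_smul,
    hη, he, Real.norm_eq_abs, mul_one, sq_abs]
  congr 1; ring

theorem two_mul_abs_lt {r t : ℝ} (hr0 : 0 ≤ r) (hr : r < 1) (ht : |t| ≤ 1) :
    2 * r * |t| < 1 + r ^ 2 := by
  nlinarith [mul_le_mul_of_nonneg_left ht hr0, sq_nonneg (1 - r), mul_pos (sub_pos.2 hr) (sub_pos.2 hr)]

theorem one_add_sq_sub_pos {r t : ℝ} (hr0 : 0 ≤ r) (hr : r < 1) (ht : |t| ≤ 1) :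
    0 < 1 + r ^ 2 - 2 * r * t := by
  nlinarith [two_mul_abs_lt hr0 hr ht, le_abs_self t]

theorem continuous_evenKernel_inner {a r : ℝ} (hr0 : 0 ≤ r) (hr : r < 1)
    {e : EuclideanSpace ℝ (Fin n)} (he : ‖e‖ = 1) :
    Continuous fun η : Sph n => evenKernel a r (inner ℝ (η : EuclideanSpace ℝ (Fin n)) e) := by
  unfold evenKernel
  refine Continuous.add ?_ ?_
  · refine Continuous.rpow_const (by fun_prop) fun η => Or.inl ?_
    exact (one_add_sq_sub_pos hr0 hr (abs_inner_sph_le η he)).ne'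
  · refine Continuous.rpow_const (by fun_prop) fun η => Or.inl ?_
    have := one_add_sq_sub_pos hr0 hr (t := -inner ℝ (η : EuclideanSpace ℝ (Fin n)) e)
      (by rw [abs_neg]; exact abs_inner_sph_le η he)
    rw [mul_neg, sub_neg_eq_add] at this
    exact this.ne'

theorem continuous_norm_sub_rpow {x : EuclideanSpace ℝ (Fin n)} (hx : ‖x‖ < 1) (a : ℝ) :
    Continuous fun η : Sph n => ‖(η : EuclideanSpace ℝ (Fin n)) - x‖ ^ a := by
  refine Continuous.rpow_const (by fun_prop) fun η => Or.inl ?_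
  exact (norm_sub_pos_of_norm_lt_one hx (norm_coe_sph η)).ne'

/-- Averaging over `η` and `-η`; the factor `|⟨η, l⟩|^q` is even. -/
theorem rieszIntegral_smul_eq [NeZero n] {a q r : ℝ} (hr0 : 0 ≤ r) (hr : r < 1) (hq : 0 ≤ q)
    {e : EuclideanSpace ℝ (Fin n)} (he : ‖e‖ = 1) (l : EuclideanSpace ℝ (Fin n)) :
    rieszIntegral a q (r • e) l = 1 / 2 * ∫ η : Sph n,
      evenKernel a r (inner ℝ (η : EuclideanSpace ℝ (Fin n)) e) *
        |inner ℝ (η : EuclideanSpace ℝ (Fin n)) l| ^ q ∂sigma n := by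
  have hx : ‖r • e‖ < 1 := by rwa [norm_smul, he, mul_one, Real.norm_of_nonneg hr0]
  have hx' : ‖-(r • e)‖ < 1 := by rwa [norm_neg]
  have hl : Continuous fun η : Sph n => |inner ℝ (η : EuclideanSpace ℝ (Fin n)) l| ^ q :=
    Continuous.rpow_const (by fun_prop) fun η => Or.inr hq
  have hneg := integral_sigma_neg (fun η : EuclideanSpace ℝ (Fin n) =>
    ‖η - r • e‖ ^ (2 * a) * |inner ℝ η l| ^ q)
  have i1 := integrable_sigma_of_continuous ((continuous_norm_sub_rpow hx (2 * a)).fun_mul hl)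
  have i2 := integrable_sigma_of_continuous ((continuous_norm_sub_rpow hx' (2 * a)).fun_mul hl)
  have e2 : ∀ η : Sph n, ‖-(η : EuclideanSpace ℝ (Fin n)) - r • e‖ ^ (2 * a) *
      |inner ℝ (-(η : EuclideanSpace ℝ (Fin n))) l| ^ q =
      ‖(η : EuclideanSpace ℝ (Fin n)) - -(r • e)‖ ^ (2 * a) *
        |inner ℝ (η : EuclideanSpace ℝ (Fin n)) l| ^ q := by
    intro η
    rw [inner_neg_left, abs_neg, ← norm_neg (η - -(r • e) : EuclideanSpace ℝ (Fin n))]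
    congr 3; abel
  simp_rw [e2] at hneg
  have e3 : ∀ η : Sph n, evenKernel a r (inner ℝ (η : EuclideanSpace ℝ (Fin n)) e) *
        |inner ℝ (η : EuclideanSpace ℝ (Fin n)) l| ^ q =
      ‖(η : EuclideanSpace ℝ (Fin n)) - r • e‖ ^ (2 * a) *
        |inner ℝ (η : EuclideanSpace ℝ (Fin n)) l| ^ q +
      ‖(η : EuclideanSpace ℝ (Fin n)) - -(r • e)‖ ^ (2 * a) *
        |inner ℝ (η : EuclideanSpace ℝ (Fin n)) l| ^ q := by
    intro η
    rw [← neg_smul, norm_sub_smul_rpow (norm_coe_sph η) he, norm_sub_smul_rpow (norm_coe_sph η) he,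
      evenKernel, neg_sq, ← add_mul]
    congr 3; ring
  simp_rw [e3]
  rw [integral_add i1 i2, hneg, rieszIntegral]
  ring

theorem evenKernel_abs (a r t : ℝ) : evenKernel a r |t| = evenKernel a r t := by
  rcases abs_choice t with h | h <;> rw [h]
  rw [evenKernel, evenKernel, add_comm]
  congr 2 <;> ring

theorem evenKernel_le_evenKernel {a r s t : ℝ} (ha : a ≤ 0 ∨ 1 ≤ a) (hr0 : 0 ≤ r) (hr : r < 1)
    (hst : |s| ≤ |t|) (ht : |t| ≤ 1) : evenKernel a r s ≤ evenKernel a r t := by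
  have hf : ConvexOn ℝ (Set.Ioi 0) fun x : ℝ => x ^ a := by
    rcases ha with ha | ha
    · exact convexOn_rpow_of_nonpos ha
    · exact (convexOn_rpow ha).subset Set.Ioi_subset_Ici_self (convex_Ioi 0)
  rw [← evenKernel_abs a r t]
  refine hf.add_le_add_of_abs_le (D := 1 + r ^ 2) ?_ (two_mul_abs_lt hr0 hr ht)
  rw [abs_mul, abs_of_nonneg (by positivity : 0 ≤ 2 * r)]
  gcongr

theorem evenKernel_le_evenKernel_of_concave {a r s t : ℝ} (ha0 : 0 ≤ a) (ha : a ≤ 1) (hr0 : 0 ≤ r)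
    (hr : r < 1) (hst : |s| ≤ |t|) (ht : |t| ≤ 1) : evenKernel a r t ≤ evenKernel a r s := by
  have hf : ConvexOn ℝ (Set.Ioi 0) (-fun x : ℝ => x ^ a) :=
    ((Real.concaveOn_rpow ha0 ha).subset Set.Ioi_subset_Ici_self (convex_Ioi 0)).neg
  rw [← evenKernel_abs a r t]
  have := hf.add_le_add_of_abs_le (D := 1 + r ^ 2) (s := 2 * r * s) (t := 2 * r * |t|) (by
    rw [abs_mul, abs_of_nonneg (by positivity : 0 ≤ 2 * r)]
    gcongr) (two_mul_abs_lt hr0 hr ht)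
  simp only [Pi.neg_apply] at this
  unfold evenKernel
  linarith

theorem continuous_abs_rpow {q : ℝ} (hq : 0 ≤ q) : Continuous fun t : ℝ => |t| ^ q :=
  Continuous.rpow_const continuous_abs fun _ => Or.inr hq

/-- Under the reflection exchanging `e` and `l`, both the even kernel and `|·|^q` increase with the
absolute value, so the products are largest when the two are aligned. -/
theorem rieszIntegral_le_self [NeZero n] {a q r : ℝ} (ha : a ≤ 0 ∨ 1 ≤ a) (hr0 : 0 ≤ r) (hr : r < 1)
    (hq : 0 ≤ q) {e l : EuclideanSpace ℝ (Fin n)} (he : ‖e‖ = 1) (hl : ‖l‖ = 1) :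
    rieszIntegral a q (r • e) l ≤ rieszIntegral a q (r • e) e := by
  rw [rieszIntegral_smul_eq hr0 hr hq he, rieszIntegral_smul_eq hr0 hr hq he]
  refine mul_le_mul_of_nonneg_left ?_ (by norm_num)
  set R := (ℝ ∙ (e - l))ᗮ.reflection with hRdef
  have hRe : R e = l := Submodule.reflection_sub (by rw [he, hl])
  have := integral_mul_le_of_swap (R := R) (fun y => Submodule.reflection_reflection _ y)
    (G := evenKernel a r) (h := fun t => |t| ^ q) (p := e) (v := e)
    (continuous_evenKernel_inner hr0 hr he) (by
      rw [hRe]; exact continuous_evenKernel_inner hr0 hr hl) (continuous_abs_rpow hq) (by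
      intro η
      rw [hRe]
      have h1 := abs_inner_sph_le η he
      have h2 := abs_inner_sph_le η hl
      rcases le_total |inner ℝ (η : EuclideanSpace ℝ (Fin n)) e|
        |inner ℝ (η : EuclideanSpace ℝ (Fin n)) l| with h | h
      · exact mul_nonpos_of_nonpos_of_nonneg
          (sub_nonpos.2 (evenKernel_le_evenKernel ha hr0 hr h h2))
          (sub_nonneg.2 (Real.rpow_le_rpow (abs_nonneg _) h hq))
      · exact mul_nonpos_of_nonneg_of_nonpos
          (sub_nonneg.2 (evenKernel_le_evenKernel ha hr0 hr h h1))
          (sub_nonpos.2 (Real.rpow_le_rpow (abs_nonneg _) h hq)))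
  rwa [hRe] at this

/-- Here the kernel decreases in `|⟨η, e⟩|`. The reflection exchanging `m` and `l` acts on the plane
of `e` and `m`, so by Pythagoras `|⟨η, R e⟩|` exceeds `|⟨η, e⟩|` exactly when `|⟨η, l⟩|` falls below
`|⟨η, m⟩|`. -/
theorem rieszIntegral_le_of_orthogonal [NeZero n] {a q r : ℝ} (ha0 : 0 ≤ a) (ha : a ≤ 1) (hr0 : 0 ≤ r)
    (hr : r < 1) (hq : 0 ≤ q) {e m : EuclideanSpace ℝ (Fin n)} (he : ‖e‖ = 1) (hm : ‖m‖ = 1)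
    (hem : inner ℝ e m = 0) {c s : ℝ} (hcs : c ^ 2 + s ^ 2 = 1) :
    rieszIntegral a q (r • e) (c • e + s • m) ≤ rieszIntegral a q (r • e) m := by
  -- For `c = 0` one has `l = ±m` and equality; the formula for `R e` below is obtained by
  -- cancelling `c`.
  rcases eq_or_ne c 0 with rfl | hc
  · have hs : |s| = 1 := by
      rw [← sq_eq_sq₀ (abs_nonneg s) zero_le_one, sq_abs]; linarith
    refine le_of_eq (integral_congr_ae (ae_of_all _ fun η => ?_))
    simp [inner_smul_right, abs_mul, hs]
  have hme : inner ℝ m e = 0 := by rw [real_inner_comm]; exact hem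
  set l := c • e + s • m with hl
  have hl1 : ‖l‖ = 1 := by
    have : ‖l‖ ^ 2 = 1 := by
      rw [hl, norm_add_sq_real, norm_smul, norm_smul, inner_smul_left, inner_smul_right, he, hm, hem]
      simpa using hcs
    exact (pow_eq_one_iff_of_nonneg (norm_nonneg _) two_ne_zero).1 this
  rw [rieszIntegral_smul_eq hr0 hr hq he, rieszIntegral_smul_eq hr0 hr hq he]
  refine mul_le_mul_of_nonneg_left ?_ (by norm_num)
  set R := (ℝ ∙ (m - l))ᗮ.reflection with hRdef
  have hRm : R m = l := Submodule.reflection_sub (by rw [hm, hl1])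
  have hRl : R l = m := by rw [← hRm]; exact Submodule.reflection_reflection _ m
  have hRe : R e = c • m - s • e := by
    have h1 : c • R e + s • l = m := by
      have : R (c • e + s • m) = m := hRl
      rwa [map_add, map_smul, map_smul, hRm] at this
    have h2 : c • (c • m - s • e) + s • l = m := by
      rw [hl]
      have : c • (c • m - s • e) + s • (c • e + s • m) = (c ^ 2 + s ^ 2) • m := by module
      rw [this, hcs, one_smul]
    exact smul_right_injective _ hc (add_right_cancel (h1.trans h2.symm))
  have hRe1 : ‖R e‖ = 1 := by rw [LinearIsometryEquiv.norm_map, he]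
  have := integral_mul_le_of_swap (R := R) (fun y => Submodule.reflection_reflection _ y)
    (G := evenKernel a r) (h := fun t => |t| ^ q) (p := e) (v := m)
    (continuous_evenKernel_inner hr0 hr he)
    (continuous_evenKernel_inner hr0 hr hRe1) (continuous_abs_rpow hq) (by
      intro η
      have h1 := abs_inner_sph_le η he
      have h2 := abs_inner_sph_le η hRe1
      have hsq : inner ℝ (η : EuclideanSpace ℝ (Fin n)) e ^ 2 +
          inner ℝ (η : EuclideanSpace ℝ (Fin n)) m ^ 2 =
          inner ℝ (η : EuclideanSpace ℝ (Fin n)) l ^ 2 +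
          inner ℝ (η : EuclideanSpace ℝ (Fin n)) (R e) ^ 2 := by
        rw [hRe, hl]
        simp only [inner_add_right, inner_sub_right, inner_smul_right]
        linear_combination -(inner ℝ (η : EuclideanSpace ℝ (Fin n)) e ^ 2 +
          inner ℝ (η : EuclideanSpace ℝ (Fin n)) m ^ 2) * hcs
      rw [hRm]
      rcases le_total |inner ℝ (η : EuclideanSpace ℝ (Fin n)) e|
        |inner ℝ (η : EuclideanSpace ℝ (Fin n)) (R e)| with h | h
      · have h' := sq_le_sq.2 h
        have h3 := sq_le_sq.1 (show inner ℝ (η : EuclideanSpace ℝ (Fin n)) l ^ 2 ≤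
          inner ℝ (η : EuclideanSpace ℝ (Fin n)) m ^ 2 by linarith)
        exact mul_nonpos_of_nonneg_of_nonpos
          (sub_nonneg.2 (evenKernel_le_evenKernel_of_concave ha0 ha hr0 hr h h2))
          (sub_nonpos.2 (Real.rpow_le_rpow (abs_nonneg _) h3 hq))
      · have h' := sq_le_sq.2 h
        have h3 := sq_le_sq.1 (show inner ℝ (η : EuclideanSpace ℝ (Fin n)) m ^ 2 ≤
          inner ℝ (η : EuclideanSpace ℝ (Fin n)) l ^ 2 by linarith)
        exact mul_nonpos_of_nonpos_of_nonneg
          (sub_nonpos.2 (evenKernel_le_evenKernel_of_concave ha0 ha hr0 hr h h1))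
          (sub_nonneg.2 (Real.rpow_le_rpow (abs_nonneg _) h3 hq)))
  rwa [hRm] at this

end Comparison

/-! ### Series evaluation of the integral in the parallel and orthogonal directions. -/

section Evaluation

theorem Gamma_add_nat_eq {x : ℝ} (hx : 0 < x) (k : ℕ) :
    Real.Gamma (x + k) = (ascPochhammer ℝ k).eval x * Real.Gamma x := by
  induction k with
  | zero => simp
  | succ k ih =>
    rw [ascPochhammer_succ_eval, Nat.cast_succ, ← add_assoc, Real.Gamma_add_one (by positivity), ih]
    ring

theorem exists_norm_eq_one_inner_eq_zero {n : ℕ} (hn : 2 ≤ n) (e : EuclideanSpace ℝ (Fin n)) :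
    ∃ m : EuclideanSpace ℝ (Fin n), ‖m‖ = 1 ∧ inner ℝ e m = 0 := by
  have hne : (ℝ ∙ e)ᗮ ≠ ⊥ := by
    intro h
    rw [Submodule.orthogonal_eq_bot_iff] at h
    have h1 := finrank_span_le_card (R := ℝ) ({e} : Set (EuclideanSpace ℝ (Fin n)))
    rw [h, finrank_top, finrank_euclideanSpace_fin] at h1
    simp at h1
    omega
  obtain ⟨v, hv, hv0⟩ := Submodule.exists_mem_ne_zero_of_ne_bot hne
  refine ⟨‖v‖⁻¹ • v, norm_inv_norm_smul hv0, ?_⟩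
  rw [inner_smul_right, Submodule.mem_orthogonal_singleton_iff_inner_right.1 hv, mul_zero]

theorem exists_orthogonal_decomposition {n : ℕ} (hn : 2 ≤ n) {e l : EuclideanSpace ℝ (Fin n)}
    (he : ‖e‖ = 1) (hl : ‖l‖ = 1) :
    ∃ (m : EuclideanSpace ℝ (Fin n)) (c s : ℝ), ‖m‖ = 1 ∧ inner ℝ e m = 0 ∧ c ^ 2 + s ^ 2 = 1 ∧
      l = c • e + s • m := by
  have hv : inner ℝ e (l - inner ℝ e l • e) = 0 := by
    rw [inner_sub_right, inner_smul_right, real_inner_self_eq_norm_sq, he]; ring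
  have hnorm : inner ℝ e l ^ 2 + ‖l - inner ℝ e l • e‖ ^ 2 = 1 := by
    rw [norm_sub_sq_real, inner_smul_right, norm_smul, he, hl, real_inner_comm, mul_one,
      Real.norm_eq_abs, sq_abs]
    ring
  rcases eq_or_ne (l - inner ℝ e l • e) 0 with h0 | h0
  · obtain ⟨m, hm, hem⟩ := exists_norm_eq_one_inner_eq_zero hn e
    rw [h0, norm_zero] at hnorm
    refine ⟨m, inner ℝ e l, 0, hm, hem, hnorm, ?_⟩
    rw [zero_smul, add_zero]
    exact sub_eq_zero.1 h0
  · refine ⟨‖l - inner ℝ e l • e‖⁻¹ • (l - inner ℝ e l • e), inner ℝ e l, ‖l - inner ℝ e l • e‖,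
      norm_inv_norm_smul h0, ?_, hnorm, ?_⟩
    · rw [inner_smul_right, hv, mul_zero]
    · rw [smul_smul, mul_inv_cancel₀ (norm_ne_zero_iff.2 h0)]
      module

/-- The value of `∫ |⟨η, m⟩|^B` over the unit sphere for a unit vector `m`. -/
noncomputable def sphMoment (n : ℕ) (B : ℝ) : ℝ :=
  Real.Gamma (n / 2) * Real.Gamma ((B + 1) / 2) / (√Real.pi * Real.Gamma ((B + n) / 2))

variable {n : ℕ}

theorem integral_sigma_inner_pow_mul_abs_rpow [NeZero n] {e m : EuclideanSpace ℝ (Fin n)}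
    (he : ‖e‖ = 1) (hm : ‖m‖ = 1) (hem : inner ℝ e m = 0) {B : ℝ} (hB : 0 ≤ B) (k : ℕ) :
    ∫ η : Sph n, inner ℝ (η : EuclideanSpace ℝ (Fin n)) e ^ (2 * k) *
        |inner ℝ (η : EuclideanSpace ℝ (Fin n)) m| ^ B ∂sigma n =
      sphMoment n B * ((ascPochhammer ℝ k).eval (1 / 2) /
        (ascPochhammer ℝ k).eval ((B + n) / 2)) := by
  have hn : (0 : ℝ) < n := Nat.cast_pos.2 (Nat.pos_of_neZero n)
  have h := integral_sigma_abs_rpow_mul_abs_rpow he hm hem (A := ((2 * k : ℕ) : ℝ)) (B := B)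
    (Nat.cast_nonneg _) hB
  simp only [Real.rpow_natCast] at h
  simp only [pow_mul, sq_abs] at h ⊢
  rw [h, sphMoment]
  have e1 : (((2 * k : ℕ) : ℝ) + 1) / 2 = 1 / 2 + k := by push_cast; ring
  have e2 : ((n : ℝ) + (((2 * k : ℕ) : ℝ) + B)) / 2 = (B + n) / 2 + k := by push_cast; ring
  rw [e1, e2, Gamma_add_nat_eq (by norm_num), Gamma_add_nat_eq (by positivity),
    Real.Gamma_one_half_eq]
  have h1 : 0 < (ascPochhammer ℝ k).eval ((B + n) / 2) := ascPochhammer_pos _ _ (by positivity)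
  have h2 : 0 < Real.Gamma ((B + n) / 2) := Real.Gamma_pos_of_pos (by positivity)
  have h3 : Real.pi = √Real.pi * √Real.pi := (Real.mul_self_sqrt Real.pi_pos.le).symm
  have h4 : 0 < √Real.pi := Real.sqrt_pos.2 Real.pi_pos
  generalize √Real.pi = t at *
  rw [h3]
  field_simp

theorem integral_sigma_abs_rpow [NeZero n] (hn : 2 ≤ n) {m : EuclideanSpace ℝ (Fin n)}
    (hm : ‖m‖ = 1) {B : ℝ} (hB : 0 ≤ B) :
    ∫ η : Sph n, |inner ℝ (η : EuclideanSpace ℝ (Fin n)) m| ^ B ∂sigma n = sphMoment n B := by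
  obtain ⟨e, he, hme⟩ := exists_norm_eq_one_inner_eq_zero hn m
  rw [real_inner_comm] at hme
  simpa using integral_sigma_inner_pow_mul_abs_rpow he hm hme hB 0

theorem integral_sigma_inner_pow_mul_abs_rpow_self [NeZero n] (hn : 2 ≤ n)
    {e : EuclideanSpace ℝ (Fin n)} (he : ‖e‖ = 1) {B : ℝ} (hB : 0 ≤ B) (k : ℕ) :
    ∫ η : Sph n, inner ℝ (η : EuclideanSpace ℝ (Fin n)) e ^ (2 * k) *
        |inner ℝ (η : EuclideanSpace ℝ (Fin n)) e| ^ B ∂sigma n =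
      sphMoment n B * ((ascPochhammer ℝ k).eval ((B + 1) / 2) /
        (ascPochhammer ℝ k).eval ((B + n) / 2)) := by
  have hn0 : (0 : ℝ) < n := Nat.cast_pos.2 (Nat.pos_of_neZero n)
  have h := integral_sigma_abs_rpow hn he (B := ((2 * k : ℕ) : ℝ) + B) (by positivity)
  have e0 : ∀ η : Sph n, |inner ℝ (η : EuclideanSpace ℝ (Fin n)) e| ^ (((2 * k : ℕ) : ℝ) + B) =
      inner ℝ (η : EuclideanSpace ℝ (Fin n)) e ^ (2 * k) *
        |inner ℝ (η : EuclideanSpace ℝ (Fin n)) e| ^ B := by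
    intro η
    rw [Real.rpow_add_of_nonneg (abs_nonneg _) (Nat.cast_nonneg _) hB, Real.rpow_natCast, pow_mul,
      sq_abs, pow_mul]
  simp_rw [e0] at h
  rw [h, sphMoment, sphMoment]
  have e1 : (((2 * k : ℕ) : ℝ) + B + 1) / 2 = (B + 1) / 2 + k := by push_cast; ring
  have e2 : (((2 * k : ℕ) : ℝ) + B + (n : ℝ)) / 2 = (B + n) / 2 + k := by push_cast; ring
  rw [e1, e2, Gamma_add_nat_eq (by positivity), Gamma_add_nat_eq (by positivity)]
  have h1 : 0 < (ascPochhammer ℝ k).eval ((B + n) / 2) := ascPochhammer_pos _ _ (by positivity)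
  have h2 : 0 < Real.Gamma ((B + n) / 2) := Real.Gamma_pos_of_pos (by positivity)
  field_simp

/-- Termwise integration of the binomial series, dominated by `|choose a j * ρ^j|`. The terms of odd
degree vanish under `η ↦ -η`. -/
theorem hasSum_integral_one_sub_rpow [NeZero n] (a : ℝ) {ρ : ℝ} (hρ : |ρ| < 1)
    {e m : EuclideanSpace ℝ (Fin n)} (he : ‖e‖ = 1) (hm : ‖m‖ = 1) {B : ℝ} (hB : 0 ≤ B) :
    HasSum (fun k : ℕ => Ring.choose a (2 * k) * ρ ^ (2 * k) *
        ∫ η : Sph n, inner ℝ (η : EuclideanSpace ℝ (Fin n)) e ^ (2 * k) *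
          |inner ℝ (η : EuclideanSpace ℝ (Fin n)) m| ^ B ∂sigma n)
      (∫ η : Sph n, (1 - ρ * inner ℝ (η : EuclideanSpace ℝ (Fin n)) e) ^ a *
        |inner ℝ (η : EuclideanSpace ℝ (Fin n)) m| ^ B ∂sigma n) := by
  let F : ℕ → Sph n → ℝ := fun j η =>
    Ring.choose a j * (-(ρ * inner ℝ (η : EuclideanSpace ℝ (Fin n)) e)) ^ j *
      |inner ℝ (η : EuclideanSpace ℝ (Fin n)) m| ^ B
  have hm' : Continuous fun η : Sph n => |inner ℝ (η : EuclideanSpace ℝ (Fin n)) m| ^ B :=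
    (continuous_abs_rpow hB).comp (by fun_prop)
  have hFc : ∀ j, Continuous (F j) := fun j => Continuous.fun_mul (by fun_prop) hm'
  have hFi : ∀ j, Integrable (F j) (sigma n) := fun j => integrable_sigma_of_continuous (hFc j)
  have hFb : ∀ j η, ‖F j η‖ ≤ |Ring.choose a j * ρ ^ j| := by
    intro j η
    simp only [F, Real.norm_eq_abs]
    rw [abs_mul, abs_mul, abs_mul, abs_pow, abs_neg, abs_mul, mul_pow, abs_pow]
    have h1 := abs_inner_sph_le η he
    have h2 : |(|inner ℝ (η : EuclideanSpace ℝ (Fin n)) m| ^ B)| ≤ 1 := by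
      rw [abs_of_nonneg (by positivity)]
      exact Real.rpow_le_one (abs_nonneg _) (abs_inner_sph_le η hm) hB
    have h3 : |inner ℝ (η : EuclideanSpace ℝ (Fin n)) e| ^ j ≤ 1 := pow_le_one₀ (abs_nonneg _) h1
    calc |Ring.choose a j| * (|ρ| ^ j * |inner ℝ (η : EuclideanSpace ℝ (Fin n)) e| ^ j) *
          |(|inner ℝ (η : EuclideanSpace ℝ (Fin n)) m| ^ B)|
        ≤ |Ring.choose a j| * (|ρ| ^ j * 1) * 1 := by gcongr
      _ = _ := by ring
  have hsum : Summable fun j => ∫ η, ‖F j η‖ ∂sigma n := by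
    refine Summable.of_nonneg_of_le (fun j => integral_nonneg fun η => norm_nonneg _) (fun j => ?_)
      (summable_abs_choose a hρ)
    refine (integral_mono (hFi j).norm (integrable_const _) (hFb j)).trans ?_
    simp
  have h := hasSum_integral_of_summable_integral_norm hFi hsum
  have hpt : ∀ η : Sph n, ∑' j, F j η =
      (1 - ρ * inner ℝ (η : EuclideanSpace ℝ (Fin n)) e) ^ a *
        |inner ℝ (η : EuclideanSpace ℝ (Fin n)) m| ^ B := by
    intro η
    have hlt : |-(ρ * inner ℝ (η : EuclideanSpace ℝ (Fin n)) e)| < 1 := by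
      rw [abs_neg, abs_mul]
      exact (mul_le_of_le_one_right (abs_nonneg _) (abs_inner_sph_le η he)).trans_lt hρ
    rw [sub_eq_add_neg]
    exact ((hasSum_one_add_rpow a hlt).mul_right _).tsum_eq
  simp_rw [hpt] at h
  have hodd : ∀ j, j ∉ Set.range (fun k : ℕ => 2 * k) → ∫ η, F j η ∂sigma n = 0 := by
    intro j hj
    have hj' : Odd j := by
      rw [← Nat.not_even_iff_odd]
      rintro ⟨k, hk⟩
      exact hj ⟨k, by simp only; omega⟩
    have hneg := integral_sigma_neg (fun η : EuclideanSpace ℝ (Fin n) =>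
      Ring.choose a j * (-(ρ * inner ℝ η e)) ^ j * |inner ℝ η m| ^ B)
    have : ∀ η : Sph n, Ring.choose a j * (-(ρ * inner ℝ (-(η : EuclideanSpace ℝ (Fin n))) e)) ^ j *
        |inner ℝ (-(η : EuclideanSpace ℝ (Fin n))) m| ^ B = -F j η := by
      intro η
      simp only [F, inner_neg_left, abs_neg, mul_neg]
      rw [hj'.neg_pow (-_)]
      ring
    simp_rw [this] at hneg
    rw [integral_neg] at hneg
    change -∫ η, F j η ∂sigma n = ∫ η, F j η ∂sigma n at hneg
    linarith
  have hinj : Function.Injective (fun k : ℕ => 2 * k) := fun i j hij => by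
    simp only at hij; omega
  have h2 := (hinj.hasSum_iff hodd).2 h
  convert h2 using 1
  funext k
  simp only [Function.comp_apply, F]
  rw [← integral_const_mul]
  congr with η
  rw [(even_two_mul k).neg_pow, mul_pow]
  ring

theorem one_sub_sq_pos_of_lt {r : ℝ} (hr0 : 0 ≤ r) (hr : r < 1) : |2 * r / (1 + r ^ 2)| < 1 := by
  rw [abs_of_nonneg (by positivity), div_lt_one (by positivity)]
  nlinarith [mul_pos (sub_pos.2 hr) (sub_pos.2 hr)]

/-- Uses `|η - r e|² = (1 + r²)(1 - ρ ⟨η, e⟩)` with `ρ = 2r / (1 + r²)`. -/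
theorem hasSum_rieszIntegral [NeZero n] (a : ℝ) {r : ℝ} (hr0 : 0 ≤ r) (hr : r < 1)
    {e m : EuclideanSpace ℝ (Fin n)} (he : ‖e‖ = 1) (hm : ‖m‖ = 1) {B : ℝ} (hB : 0 ≤ B) :
    HasSum (fun k : ℕ => (1 + r ^ 2) ^ a *
      (Ring.choose a (2 * k) * (4 * r ^ 2 / (1 + r ^ 2) ^ 2) ^ k *
        ∫ η : Sph n, inner ℝ (η : EuclideanSpace ℝ (Fin n)) e ^ (2 * k) *
          |inner ℝ (η : EuclideanSpace ℝ (Fin n)) m| ^ B ∂sigma n))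
      (rieszIntegral a B (r • e) m) := by
  have hρ := one_sub_sq_pos_of_lt hr0 hr
  have h := (hasSum_integral_one_sub_rpow a hρ he hm hB).mul_left ((1 + r ^ 2) ^ a)
  have e1 : (1 + r ^ 2) ^ a * ∫ η : Sph n, (1 - 2 * r / (1 + r ^ 2) *
      inner ℝ (η : EuclideanSpace ℝ (Fin n)) e) ^ a *
        |inner ℝ (η : EuclideanSpace ℝ (Fin n)) m| ^ B ∂sigma n = rieszIntegral a B (r • e) m := by
    rw [rieszIntegral, ← integral_const_mul]
    congr with η
    rw [norm_sub_smul_rpow (norm_coe_sph η) he, ← mul_assoc]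
    congr 1
    have h1 := abs_inner_sph_le η he
    have h2 : 0 ≤ 1 - 2 * r / (1 + r ^ 2) * inner ℝ (η : EuclideanSpace ℝ (Fin n)) e := by
      have := abs_mul (2 * r / (1 + r ^ 2)) (inner ℝ (η : EuclideanSpace ℝ (Fin n)) e)
      have h3 : |2 * r / (1 + r ^ 2)| * |inner ℝ (η : EuclideanSpace ℝ (Fin n)) e| ≤ 1 :=
        mul_le_one₀ hρ.le (abs_nonneg _) h1
      have := le_abs_self (2 * r / (1 + r ^ 2) * inner ℝ (η : EuclideanSpace ℝ (Fin n)) e)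
      linarith
    rw [← Real.mul_rpow (by positivity) h2]
    congr 1
    field_simp
  rw [e1] at h
  have e2 : ∀ k : ℕ, (4 * r ^ 2 / (1 + r ^ 2) ^ 2) ^ k = (2 * r / (1 + r ^ 2)) ^ (2 * k) := by
    intro k
    rw [pow_mul]; congr 1; field_simp; ring
  simpa only [e2] using h

/-- The factor `(1/2)_k` of the moment cancels the one in `choose_two_mul`, which leaves a `₂F₁`;
the quadratic transformation at `s = r²` simplifies its argument. -/
theorem rieszIntegral_orthogonal [NeZero n] (a : ℝ) {r : ℝ} (hr0 : 0 ≤ r) (hr : r < 1)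
    {e m : EuclideanSpace ℝ (Fin n)} (he : ‖e‖ = 1) (hm : ‖m‖ = 1) (hem : inner ℝ e m = 0)
    {B : ℝ} (hB : 0 ≤ B) :
    rieszIntegral a B (r • e) m =
      sphMoment n B * ordinaryHypergeometric (-a) (1 - a - (B + n) / 2) ((B + n) / 2) (r ^ 2) := by
  have hn0 : (0 : ℝ) < n := Nat.cast_pos.2 (Nat.pos_of_neZero n)
  have hc : 0 < (B + n) / 2 := by positivity
  have hr2 : r ^ 2 < 1 := by nlinarith
  rw [← quadratic_transformation a hc ⟨by nlinarith [sq_nonneg r], hr2⟩, mul_left_comm]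
  have hz : |4 * r ^ 2 / (1 + r ^ 2) ^ 2| < 1 := by
    have h1 := one_sub_sq_pos_of_lt hr0 hr
    have : 4 * r ^ 2 / (1 + r ^ 2) ^ 2 = (2 * r / (1 + r ^ 2)) ^ 2 := by field_simp; ring
    rw [this, abs_pow]
    exact pow_lt_one₀ (abs_nonneg _) h1 two_ne_zero
  refine (hasSum_rieszIntegral a hr0 hr he hm hB).unique ?_
  have h := ((hasSum_ordinaryHypergeometric (-a / 2) ((1 - a) / 2) ((B + n) / 2) hz).mul_left
    (sphMoment n B)).mul_left ((1 + r ^ 2) ^ a)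
  convert! h using 1
  funext k
  rw [integral_sigma_inner_pow_mul_abs_rpow he hm hem hB, choose_two_mul,
    ordinaryHypergeometricCoefficient]
  have h1 : (0 : ℝ) < (ascPochhammer ℝ k).eval (1 / 2) := ascPochhammer_pos _ _ (by norm_num)
  field_simp

theorem rieszIntegral_self [NeZero n] (hn : 2 ≤ n) (a : ℝ) {r : ℝ} (hr0 : 0 ≤ r) (hr : r < 1)
    {e : EuclideanSpace ℝ (Fin n)} (he : ‖e‖ = 1) {B : ℝ} (hB : 0 ≤ B) :
    rieszIntegral a B (r • e) e = (1 + r ^ 2) ^ a * sphMoment n B *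
      hyp32 (-a / 2) ((1 - a) / 2) ((B + 1) / 2) (1 / 2) ((B + n) / 2)
        (4 * r ^ 2 / (1 + r ^ 2) ^ 2) := by
  have h := hasSum_rieszIntegral a hr0 hr he he hB
  rw [← h.tsum_eq, hyp32, ← tsum_mul_left]
  refine tsum_congr fun k => ?_
  rw [integral_sigma_inner_pow_mul_abs_rpow_self hn he hB, choose_two_mul]
  have h1 : (0 : ℝ) < (ascPochhammer ℝ k).eval (1 / 2) := ascPochhammer_pos _ _ (by norm_num)
  field_simp

end Evaluation

/-! ### The gradient of the kernel and its form after the chord substitution. -/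

section Gradient

variable {n : ℕ}

/-- The gradient of the Poisson-Szegő kernel in its first variable. -/
noncomputable def kernelGrad (n : ℕ) (α : ℝ) (x ζ : EuclideanSpace ℝ (Fin n)) :
    EuclideanSpace ℝ (Fin n) :=
  (cConst n α * ((1 - ‖x‖ ^ 2) ^ (-α) * ‖x - ζ‖ ^ (α - n))) •
    (-(2 * (1 - α)) • x - ((n - α) * (1 - ‖x‖ ^ 2) / ‖x - ζ‖ ^ 2) • (x - ζ))

theorem hasFDerivAt_kernel (α : ℝ) {x ζ : EuclideanSpace ℝ (Fin n)} (hx : ‖x‖ < 1)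
    (hζ : ‖ζ‖ = 1) :
    HasFDerivAt (fun y => kernel n α y ζ) (innerSL ℝ (kernelGrad n α x ζ)) x := by
  have hκ := one_sub_norm_sq_pos hx
  have hN : 0 < ‖x - ζ‖ := by rw [norm_sub_rev]; exact norm_sub_pos_of_norm_lt_one hx hζ
  have h1 : HasFDerivAt (fun y : EuclideanSpace ℝ (Fin n) => 1 - ‖y‖ ^ 2) _ x :=
    (HasFDerivAt.norm_sq (hasFDerivAt_id x)).const_sub 1
  have h2 := h1.rpow_const (p := 1 - α) (Or.inl hκ.ne')
  have h3 : HasFDerivAt (fun y : EuclideanSpace ℝ (Fin n) => ‖y - ζ‖) _ x :=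
    (hasFDerivAt_norm_of_ne_zero (norm_pos_iff.1 hN)).comp x ((hasFDerivAt_id x).sub_const ζ)
  have h4 := h3.rpow_const (p := α - n) (Or.inl hN.ne')
  have h5 := (h2.mul h4).const_mul (cConst n α)
  have h6 : (fun y => kernel n α y ζ) = fun y =>
      cConst n α * ((1 - ‖y‖ ^ 2) ^ (1 - α) * ‖y - ζ‖ ^ (α - n)) := by
    funext y
    rw [kernel, ← neg_sub (n : ℝ) α, Real.rpow_neg (norm_nonneg _), div_eq_mul_inv]
  rw [h6]
  refine h5.congr_fderiv ?_
  ext1 v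
  have e1 : (1 - ‖x‖ ^ 2) ^ (1 - α) = (1 - ‖x‖ ^ 2) * (1 - ‖x‖ ^ 2) ^ (-α) := by
    rw [sub_eq_add_neg 1 α, Real.rpow_add hκ, Real.rpow_one]
  have e2 : ‖x - ζ‖ ^ (α - n - 1) = ‖x - ζ‖ ^ (α - n) / ‖x - ζ‖ := by
    rw [Real.rpow_sub_one hN.ne']
  have e3 : 1 - α - 1 = -α := by ring
  simp [kernelGrad, e1, e2, e3]
  generalize (1 - ‖x‖ ^ 2) ^ (-α) = p
  generalize ‖x - ζ‖ ^ (α - n) = r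
  field_simp
  ring

theorem continuousOn_kernelGrad (α : ℝ) {ρ : ℝ} (hρ : ρ < 1) :
    ContinuousOn (fun z : EuclideanSpace ℝ (Fin n) × Sph n => kernelGrad n α z.1 z.2)
      (closedBall 0 ρ ×ˢ Set.univ) := by
  have hz : ∀ z ∈ closedBall (0 : EuclideanSpace ℝ (Fin n)) ρ ×ˢ (Set.univ : Set (Sph n)),
      ‖z.1‖ < 1 := fun z hz => (mem_closedBall_zero_iff.1 hz.1).trans_lt hρ
  have hN : ∀ z ∈ closedBall (0 : EuclideanSpace ℝ (Fin n)) ρ ×ˢ (Set.univ : Set (Sph n)),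
      ‖z.1 - (z.2 : EuclideanSpace ℝ (Fin n))‖ ≠ 0 := fun z h => by
    rw [norm_sub_rev]; exact (norm_sub_pos_of_norm_lt_one (hz z h) (norm_coe_sph z.2)).ne'
  unfold kernelGrad
  refine ContinuousOn.fun_smul (ContinuousOn.fun_mul continuousOn_const (ContinuousOn.fun_mul ?_ ?_))
    (ContinuousOn.fun_sub ?_ (ContinuousOn.fun_smul (ContinuousOn.div ?_ ?_ ?_) ?_))
  · exact ContinuousOn.rpow_const (by fun_prop) fun z h =>
      Or.inl (one_sub_norm_sq_pos (hz z h)).ne'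
  · exact ContinuousOn.rpow_const (by fun_prop) fun z h => Or.inl (hN z h)
  · fun_prop
  · fun_prop
  · fun_prop
  · exact fun z h => pow_ne_zero 2 (hN z h)
  · fun_prop

theorem continuous_kernelGrad (α : ℝ) {x : EuclideanSpace ℝ (Fin n)} (hx : ‖x‖ < 1) :
    Continuous fun ζ : Sph n => kernelGrad n α x ζ := by
  rw [← continuousOn_univ]
  exact (continuousOn_kernelGrad α hx).comp (f := fun ζ : Sph n => (x, ζ)) (by fun_prop)
    fun ζ _ => ⟨by simp, trivial⟩

theorem continuous_kernel (α : ℝ) {x : EuclideanSpace ℝ (Fin n)} (hx : ‖x‖ < 1) :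
    Continuous fun ζ : Sph n => kernel n α x ζ := by
  have hN : ∀ ζ : Sph n, 0 < ‖x - (ζ : EuclideanSpace ℝ (Fin n))‖ := fun ζ => by
    rw [norm_sub_rev]; exact norm_sub_pos_of_norm_lt_one hx (norm_coe_sph ζ)
  unfold kernel
  refine continuous_const.mul (continuous_const.div ?_ fun ζ => (Real.rpow_pos_of_pos (hN ζ) _).ne')
  exact Continuous.rpow_const (by fun_prop) fun ζ => Or.inl (hN ζ).ne'

/-- Differentiation under the integral sign. On a closed ball of radius `ρ`, with `|x| < ρ < 1`, the
kernel gradient is bounded by compactness, so a multiple of `|φ|` dominates. -/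
theorem hasFDerivAt_poisson [NeZero n] (α : ℝ) {φ : Sph n → ℝ} (hφ : Integrable φ (sigma n))
    {x : EuclideanSpace ℝ (Fin n)} (hx : ‖x‖ < 1) :
    Integrable (fun ζ => φ ζ • innerSL ℝ (kernelGrad n α x ζ)) (sigma n) ∧
    HasFDerivAt (poisson n α φ) (∫ ζ, φ ζ • innerSL ℝ (kernelGrad n α x ζ) ∂sigma n) x := by
  obtain ⟨ρ, hρ1, hρ2⟩ := exists_between hx
  obtain ⟨M, hM⟩ := ((isCompact_closedBall (0 : EuclideanSpace ℝ (Fin n)) ρ).prod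
    (isCompact_univ (X := Sph n))).exists_bound_of_continuousOn (continuousOn_kernelGrad α hρ2)
  have hs : ball (0 : EuclideanSpace ℝ (Fin n)) ρ ∈ nhds x :=
    isOpen_ball.mem_nhds (mem_ball_zero_iff.2 hρ1)
  have hlt : ∀ y ∈ ball (0 : EuclideanSpace ℝ (Fin n)) ρ, ‖y‖ < 1 := fun y hy =>
    (mem_ball_zero_iff.1 hy).trans hρ2
  have hFm : ∀ y ∈ ball (0 : EuclideanSpace ℝ (Fin n)) ρ,
      AEStronglyMeasurable (fun ζ : Sph n => kernel n α y ζ * φ ζ) (sigma n) := fun y hy =>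
    (continuous_kernel α (hlt y hy)).aestronglyMeasurable.mul hφ.1
  have hF'm : AEStronglyMeasurable (fun ζ : Sph n => φ ζ • innerSL ℝ (kernelGrad n α x ζ))
      (sigma n) :=
    hφ.1.smul ((innerSL ℝ).continuous.comp (continuous_kernelGrad α hx)).aestronglyMeasurable
  have hb : ∀ ζ : Sph n, ∀ y ∈ ball (0 : EuclideanSpace ℝ (Fin n)) ρ,
      ‖φ ζ • innerSL ℝ (kernelGrad n α y ζ)‖ ≤ M * ‖φ ζ‖ := by
    intro ζ y hy
    rw [norm_smul, innerSL_apply_norm, mul_comm]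
    exact mul_le_mul_of_nonneg_right (hM (y, ζ) ⟨ball_subset_closedBall hy, trivial⟩)
      (norm_nonneg _)
  obtain ⟨M', hM'⟩ := (isCompact_univ (X := Sph n)).exists_bound_of_continuousOn
    (continuous_kernel α hx).continuousOn
  refine ⟨(hφ.norm.const_mul M).mono' hF'm (ae_of_all _ fun ζ => hb ζ x (mem_of_mem_nhds hs)), ?_⟩
  refine hasFDerivAt_integral_of_dominated_of_fderiv_le (bound := fun ζ => M * ‖φ ζ‖)
    (F' := fun y ζ => φ ζ • innerSL ℝ (kernelGrad n α y ζ)) hs ?_ ?_ hF'm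
    (ae_of_all _ hb) (hφ.norm.const_mul M) (ae_of_all _ fun ζ y hy => ?_)
  · filter_upwards [hs] with y hy using hFm y hy
  · refine (hφ.norm.const_mul M').mono' (hFm x (mem_of_mem_nhds hs)) (ae_of_all _ fun ζ => ?_)
    rw [norm_mul]
    exact mul_le_mul_of_nonneg_right (hM' ζ trivial) (norm_nonneg _)
  · exact (hasFDerivAt_kernel α (hlt y hy) (norm_coe_sph ζ)).mul_const (φ ζ)

theorem inner_gradient_poisson [NeZero n] (α : ℝ) {φ : Sph n → ℝ} (hφ : Integrable φ (sigma n))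
    {x : EuclideanSpace ℝ (Fin n)} (hx : ‖x‖ < 1) (l : EuclideanSpace ℝ (Fin n)) :
    inner ℝ (gradient (poisson n α φ) x) l =
      ∫ ζ : Sph n, φ ζ * inner ℝ (kernelGrad n α x ζ) l ∂sigma n := by
  obtain ⟨hi, hd⟩ := hasFDerivAt_poisson α hφ hx
  rw [gradient, InnerProductSpace.toDual_symm_apply, hd.fderiv,
    ContinuousLinearMap.integral_apply hi]
  rfl

theorem cConst_pos (hn : 0 < n) {α : ℝ} (hα : α < 1) : 0 < cConst n α := by
  have hn' : (1 : ℝ) ≤ n := by exact_mod_cast hn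
  rw [cConst]
  have h1 := Real.Gamma_pos_of_pos (show 0 < ((n : ℝ) - α) / 2 by linarith)
  have h2 := Real.Gamma_pos_of_pos (show 0 < 1 - α / 2 by linarith)
  have h3 := Real.Gamma_pos_of_pos (show 0 < (n : ℝ) / 2 by linarith)
  have h4 := Real.Gamma_pos_of_pos (show 0 < 1 - α by linarith)
  positivity

/-- With `ζ = chordMap x η` the bracket in `kernelGrad` becomes `-2(1 - α) x - (n - α)(η - x)`, so
the direction is affine in `η`; this is the purpose of the substitution. -/
theorem kernelGrad_chordMap (hn : 0 < n) {α : ℝ} (hα : α < 1) {x η : EuclideanSpace ℝ (Fin n)}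
    (hx : ‖x‖ < 1) (hη : ‖η‖ = 1) :
    kernelGrad n α x (chordMap x η) =
      (-(((n : ℝ) - α) * cConst n α * ((1 - ‖x‖ ^ 2) ^ (-(n : ℝ)) * ‖η - x‖ ^ ((n : ℝ) - α)))) •
        (η - (((n : ℝ) - 2 + α) / (n - α)) • x) := by
  have hn' : (1 : ℝ) ≤ n := by exact_mod_cast hn
  have hκ := one_sub_norm_sq_pos hx
  have hN := norm_sub_pos_of_norm_lt_one hx hη
  have hnα : 0 < (n : ℝ) - α := by linarith
  have e1 : ‖x - chordMap x η‖ = (1 - ‖x‖ ^ 2) / ‖η - x‖ := by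
    rw [norm_sub_rev, norm_chordMap_sub hx hη]
  have e2 : x - chordMap x η = ((1 - ‖x‖ ^ 2) / ‖η - x‖ ^ 2) • (η - x) := by
    rw [chordMap]; module
  have e3 : (1 - ‖x‖ ^ 2) ^ (-α) * ((1 - ‖x‖ ^ 2) / ‖η - x‖) ^ (α - n) =
      (1 - ‖x‖ ^ 2) ^ (-(n : ℝ)) * ‖η - x‖ ^ ((n : ℝ) - α) := by
    rw [Real.div_rpow hκ.le hN.le, ← neg_sub (n : ℝ) α, Real.rpow_neg hN.le, div_inv_eq_mul,
      ← mul_assoc, ← Real.rpow_add hκ]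
    congr 2; ring
  rw [kernelGrad, e1, e2, e3, smul_smul]
  have e4 : (n - α) * (1 - ‖x‖ ^ 2) / ((1 - ‖x‖ ^ 2) / ‖η - x‖) ^ 2 *
      ((1 - ‖x‖ ^ 2) / ‖η - x‖ ^ 2) = n - α := by
    field_simp
  rw [e4]
  match_scalars
  · field_simp
    ring
  · field_simp

theorem integral_abs_inner_kernelGrad [NeZero n] {α : ℝ} (hα : α < 1) (q : ℝ)
    {x : EuclideanSpace ℝ (Fin n)} (hx : ‖x‖ < 1) (l : EuclideanSpace ℝ (Fin n)) :
    ∫ ζ : Sph n, |inner ℝ (kernelGrad n α x ζ) l| ^ q ∂sigma n =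
      (((n : ℝ) - α) * cConst n α) ^ q * (1 - ‖x‖ ^ 2) ^ (-((n : ℝ) * (q - 1) + 1)) *
      ∫ η : Sph n, ‖(η : EuclideanSpace ℝ (Fin n)) - x‖ ^ (((n : ℝ) - α) * q - 2 * n + 2) *
        |inner ℝ ((η : EuclideanSpace ℝ (Fin n)) - (((n : ℝ) - 2 + α) / (n - α)) • x) l| ^ q
          ∂sigma n := by
  have hn := Nat.pos_of_neZero n
  have hn' : (1 : ℝ) ≤ n := by exact_mod_cast hn
  have hC := cConst_pos hn hα
  have hκ := one_sub_norm_sq_pos hx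
  have hnα : 0 < (n : ℝ) - α := by linarith
  -- The Jacobian contributes `(1 - |x|²)^(n-1)` and `|η - x|^(-2(n-1))`, whence the exponents on
  -- the right side.
  rw [← integral_sigma_chordMap hx (fun ζ => |inner ℝ (kernelGrad n α x ζ) l| ^ q),
    ← integral_const_mul]
  congr with η
  have hN := norm_sub_pos_of_norm_lt_one hx (norm_coe_sph η)
  rw [kernelGrad_chordMap hn hα hx (norm_coe_sph η), inner_smul_left, conj_trivial, abs_mul,
    abs_neg, abs_of_pos (by positivity)]
  have hP : 0 < ((n : ℝ) - α) * cConst n α := by positivity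
  generalize ((n : ℝ) - α) * cConst n α = P at *
  have e0 : (‖(η : EuclideanSpace ℝ (Fin n)) - x‖ ^ 2) ^ ((n : ℝ) - 1) =
      ‖(η : EuclideanSpace ℝ (Fin n)) - x‖ ^ (2 * ((n : ℝ) - 1)) := by
    rw [Real.rpow_mul hN.le, Real.rpow_two]
  rw [Real.mul_rpow (by positivity) (abs_nonneg _),
    Real.mul_rpow (by positivity) (by positivity), Real.mul_rpow (by positivity) (by positivity),
    ← Real.rpow_mul hκ.le, ← Real.rpow_mul hN.le, ← Real.rpow_natCast, Nat.cast_sub hn,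
    Nat.cast_one, Real.div_rpow hκ.le (by positivity), e0]
  have e1 : (1 - ‖x‖ ^ 2) ^ (-((n : ℝ) * (q - 1) + 1)) =
      (1 - ‖x‖ ^ 2) ^ ((n : ℝ) - 1) * (1 - ‖x‖ ^ 2) ^ (-(n : ℝ) * q) := by
    rw [← Real.rpow_add hκ]; congr 1; ring
  have e2 : ‖(η : EuclideanSpace ℝ (Fin n)) - x‖ ^ (((n : ℝ) - α) * q - 2 * n + 2) =
      ‖(η : EuclideanSpace ℝ (Fin n)) - x‖ ^ (((n : ℝ) - α) * q) /
        ‖(η : EuclideanSpace ℝ (Fin n)) - x‖ ^ (2 * ((n : ℝ) - 1)) := by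
    rw [← Real.rpow_sub hN]; congr 1; ring
  rw [e1, e2]
  ring

/-- Bernoulli's inequality at `-B / (A + B)`: the graph of `t^q` lies above its tangent at `A + B`.
-/
theorem add_rpow_le {A B q : ℝ} (hA : 0 ≤ A) (hB : 0 ≤ B) (hq : 1 ≤ q) :
    (A + B) ^ q ≤ A ^ q + q * B * (A + B) ^ (q - 1) := by
  rcases (add_nonneg hA hB).eq_or_lt with h | h
  · have hA0 : A = 0 := by linarith
    have hB0 : B = 0 := by linarith
    simp [hA0, hB0]
  · have hb := one_add_mul_self_le_rpow_one_add (s := -(B / (A + B))) (by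
      rw [neg_le_neg_iff, div_le_one h]; linarith) hq
    have e : 1 + -(B / (A + B)) = A / (A + B) := by field_simp; ring
    rw [e, Real.div_rpow hA h.le, le_div_iff₀ (by positivity)] at hb
    have : (A + B) ^ q = (A + B) ^ (q - 1) * (A + B) := by
      rw [← Real.rpow_add_one h.ne']; congr 1; ring
    have e2 : (1 + q * -(B / (A + B))) * (A + B) ^ q =
        (A + B) ^ q - q * B * (A + B) ^ (q - 1) := by
      rw [this]; field_simp; ring
    linarith

end Gradient

/-! ### Hölder's inequality and its extremal functions. -/

section Duality

variable {X : Type*} [MeasurableSpace X] {μ : Measure X}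

theorem abs_integral_mul_le_of_memLp {p : ENNReal} {q : ℝ} (hq : 0 < q)
    [ENNReal.HolderConjugate p (ENNReal.ofReal q)] {φ g : X → ℝ} (hφ : MemLp φ p μ)
    (hg : MemLp g (ENNReal.ofReal q) μ) :
    |∫ z, φ z * g z ∂μ| ≤ (eLpNorm φ p μ).toReal * (∫ z, |g z| ^ q ∂μ) ^ (1 / q) := by
  have h0 : 0 ≤ ∫ z, |g z| ^ q ∂μ := integral_nonneg fun z => Real.rpow_nonneg (abs_nonneg _) _
  have h1 := eLpNorm_smul_le_mul_eLpNorm (p := p) (q := ENNReal.ofReal q) (r := 1) hg.1 hφ.1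
  have h2 := hg.eLpNorm_eq_integral_rpow_norm (by simpa using hq) ENNReal.ofReal_ne_top
  rw [ENNReal.toReal_ofReal hq.le] at h2
  have h3 : |∫ z, φ z * g z ∂μ| ≤ (eLpNorm (φ • g) 1 μ).toReal := by
    rw [eLpNorm_one_eq_lintegral_enorm, ← integral_norm_eq_lintegral_enorm (hφ.1.smul hg.1)]
    exact norm_integral_le_integral_norm (μ := μ) (fun z => φ z * g z)
  refine h3.trans ?_
  have h4 := ENNReal.toReal_mono (ENNReal.mul_ne_top hφ.2.ne hg.2.ne) h1
  rwa [ENNReal.toReal_mul, h2, ENNReal.toReal_ofReal (by positivity), ← one_div] at h4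

/-- A bounded function defines a functional on `L^p` of norm at least its `L^q` norm. -/
theorem rpow_integral_le_of_forall_memLp [IsFiniteMeasure μ] {p : ENNReal} (hp : 1 < p) {q : ℝ} (hq : 1 ≤ q)
    [hpq : ENNReal.HolderConjugate p (ENNReal.ofReal q)] {g : X → ℝ} (hg : Measurable g) {M K : ℝ}
    (hM : ∀ z, |g z| ≤ M) (hK : 0 ≤ K)
    (h : ∀ φ : X → ℝ, MemLp φ p μ → ∫ z, φ z * g z ∂μ ≤ K * (eLpNorm φ p μ).toReal) :
    (∫ z, |g z| ^ q ∂μ) ^ (1 / q) ≤ K := by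
  have hq0 : 0 < q := by linarith
  -- The Hölder extremal `sign(g) |g|^(q-1)`; it is bounded, hence in every `L^r`.
  set φ : X → ℝ := fun z => g z * |g z| ^ (q - 2) with hφdef
  have hφabs : ∀ z, g z ≠ 0 → |φ z| = |g z| ^ (q - 1) := fun z hz => by
    have hz' := abs_pos.2 hz
    rw [hφdef, abs_mul, abs_of_nonneg (Real.rpow_nonneg hz'.le _), mul_comm, ← Real.rpow_add_one hz'.ne']
    congr 1; ring
  have hφ0 : ∀ z, g z = 0 → φ z = 0 := fun z hz => by simp [hφdef, hz]
  have hφm : Measurable φ := hg.mul (hg.abs.pow_const _)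
  have hφle : ∀ z, ‖φ z‖ ≤ M ^ (q - 1) := fun z => by
    rw [Real.norm_eq_abs]
    rcases eq_or_ne (g z) 0 with hz | hz
    · rw [hφ0 z hz, abs_zero]
      exact Real.rpow_nonneg ((abs_nonneg _).trans (hM z)) _
    · rw [hφabs z hz]
      exact Real.rpow_le_rpow (abs_nonneg _) (hM z) (by linarith)
  have hφL : ∀ r, MemLp φ r μ := fun r =>
    MemLp.of_bound hφm.aestronglyMeasurable _ (ae_of_all _ hφle)
  have hmul : ∀ z, φ z * g z = |g z| ^ q := fun z => by
    rcases eq_or_ne (g z) 0 with hz | hz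
    · rw [hz, mul_zero, abs_zero, Real.zero_rpow hq0.ne']
    · have hz' := abs_pos.2 hz
      rw [hφdef]
      calc g z * |g z| ^ (q - 2) * g z = |g z| ^ (q - 2) * |g z| ^ (2 : ℝ) := by
            rw [Real.rpow_two, sq_abs]; ring
        _ = _ := by rw [← Real.rpow_add hz']; congr 1; ring
  have hA0 : 0 ≤ ∫ z, |g z| ^ q ∂μ := integral_nonneg fun z => Real.rpow_nonneg (abs_nonneg _) _
  have hA := h φ (hφL p)
  simp only [hmul] at hA
  rcases hA0.eq_or_lt with hA1 | hA1
  · rwa [← hA1, Real.zero_rpow (by positivity)]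
  have hinv := hpq.inv_add_inv_eq_one
  rcases eq_or_ne p ⊤ with hpt | hpt
  -- For `p = ∞` the extremal is the sign of `g`, of norm at most one.
  · have hq1 : q = 1 := by
      rw [hpt, ENNReal.inv_top, zero_add, ENNReal.inv_eq_one] at hinv
      simpa using hinv
    have hle : (eLpNorm φ p μ).toReal ≤ 1 := by
      have h1 : eLpNorm φ p μ ≤ μ Set.univ ^ p.toReal⁻¹ * ENNReal.ofReal 1 :=
        eLpNorm_le_of_ae_bound (ae_of_all _ fun z => by simpa [hq1] using hφle z)
      rw [hpt] at h1 ⊢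
      refine ENNReal.toReal_le_of_le_ofReal zero_le_one (h1.trans ?_)
      simp
    rw [hq1, one_div_one, Real.rpow_one]
    rw [hq1] at hA
    exact hA.trans (mul_le_of_le_one_right hK hle)
  · have hp0 : p ≠ 0 := (zero_lt_one.trans hp).ne'
    have hpr : 0 < p.toReal := ENNReal.toReal_pos hp0 hpt
    have hinvr : p.toReal⁻¹ + q⁻¹ = 1 := by
      have := congrArg ENNReal.toReal hinv
      rwa [ENNReal.toReal_add (ENNReal.inv_ne_top.2 hp0) (by simpa using hq0), ENNReal.toReal_inv,
        ENNReal.toReal_inv, ENNReal.toReal_ofReal hq0.le, ENNReal.toReal_one] at this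
    -- Conjugacy gives `(q - 1) p = q`; dividing by this norm leaves the exponent `1 - 1/p = 1/q`.
    have hnorm : (eLpNorm φ p μ).toReal = (∫ z, |g z| ^ q ∂μ) ^ p.toReal⁻¹ := by
      rw [(hφL p).eLpNorm_eq_integral_rpow_norm hp0 hpt, ENNReal.toReal_ofReal
        (Real.rpow_nonneg (integral_nonneg fun z => Real.rpow_nonneg (norm_nonneg _) _) _)]
      congr 2
      funext z
      rw [Real.norm_eq_abs]
      rcases eq_or_ne (g z) 0 with hz | hz
      · rw [hφ0 z hz, hz, abs_zero, Real.zero_rpow hq0.ne', Real.zero_rpow hpr.ne']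
      · rw [hφabs z hz, ← Real.rpow_mul (abs_nonneg _)]
        congr 1
        field_simp at hinvr
        linarith
    rw [hnorm] at hA
    have hsplit : ∫ z, |g z| ^ q ∂μ =
        (∫ z, |g z| ^ q ∂μ) ^ (1 / q) * (∫ z, |g z| ^ q ∂μ) ^ p.toReal⁻¹ := by
      rw [← Real.rpow_add hA1, one_div, add_comm, hinvr, Real.rpow_one]
    rw [hsplit] at hA
    exact le_of_mul_le_mul_right (by rwa [← hsplit] at hA ⊢) (Real.rpow_pos_of_pos hA1 p.toReal⁻¹)

end Duality

/-! ### The supremum of `I` over directions, attained in each regime. -/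

section Supremum

variable {n : ℕ}

theorem exists_norm_eq_one_eq_norm_smul (hn : 2 ≤ n) (x : EuclideanSpace ℝ (Fin n)) :
    ∃ e : EuclideanSpace ℝ (Fin n), ‖e‖ = 1 ∧ x = ‖x‖ • e := by
  rcases eq_or_ne x 0 with rfl | hx
  · obtain ⟨m, hm, -⟩ := exists_norm_eq_one_inner_eq_zero hn (0 : EuclideanSpace ℝ (Fin n))
    exact ⟨m, hm, by simp⟩
  · refine ⟨‖x‖⁻¹ • x, norm_inv_norm_smul hx, ?_⟩
    rw [smul_smul, mul_inv_cancel₀ (norm_ne_zero_iff.2 hx), one_smul]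

theorem intI_eq_rieszIntegral (α q : ℝ) (x : EuclideanSpace ℝ (Fin n)) (l : Sph n) :
    intI n α q x l = rieszIntegral ((((n : ℝ) - α) * q - 2 * n + 2) / 2) q x l := by
  rw [intI, rieszIntegral, mul_div_cancel₀ _ (two_ne_zero' ℝ)]

theorem isLUB_rieszIntegral_of_concave [NeZero n] (hn : 2 ≤ n) {a q : ℝ} (ha0 : 0 ≤ a) (ha : a ≤ 1)
    (hq : 0 ≤ q) {x : EuclideanSpace ℝ (Fin n)} (hx : ‖x‖ < 1) :
    IsLUB (Set.range fun l : Sph n => rieszIntegral a q x l)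
      (sphMoment n q * ordinaryHypergeometric (-a) (1 - a - (q + n) / 2) ((q + n) / 2)
        (‖x‖ ^ 2)) := by
  obtain ⟨e, he, hxe⟩ := exists_norm_eq_one_eq_norm_smul hn x
  obtain ⟨m, hm, hem⟩ := exists_norm_eq_one_inner_eq_zero hn e
  refine IsGreatest.isLUB ⟨⟨⟨m, by simpa using hm⟩, ?_⟩, ?_⟩
  · change rieszIntegral a q x m = _
    nth_rw 1 [hxe]
    exact rieszIntegral_orthogonal a (norm_nonneg x) hx he hm hem hq
  · rintro _ ⟨l, rfl⟩
    obtain ⟨m, c, s, hm, hem, hcs, hl⟩ := exists_orthogonal_decomposition hn he (norm_coe_sph l)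
    rw [← rieszIntegral_orthogonal a (norm_nonneg x) hx he hm hem hq, ← hxe]
    have := rieszIntegral_le_of_orthogonal ha0 ha (norm_nonneg x) hx hq he hm hem hcs
    rwa [← hl, ← hxe] at this

theorem isLUB_rieszIntegral_of_convex [NeZero n] (hn : 2 ≤ n) {a q : ℝ} (ha : a ≤ 0 ∨ 1 ≤ a)
    (hq : 0 ≤ q) {x : EuclideanSpace ℝ (Fin n)} (hx : ‖x‖ < 1) :
    IsLUB (Set.range fun l : Sph n => rieszIntegral a q x l)
      ((1 + ‖x‖ ^ 2) ^ a * sphMoment n q *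
        hyp32 (-a / 2) ((1 - a) / 2) ((q + 1) / 2) (1 / 2) ((q + n) / 2)
          (4 * ‖x‖ ^ 2 / (1 + ‖x‖ ^ 2) ^ 2)) := by
  obtain ⟨e, he, hxe⟩ := exists_norm_eq_one_eq_norm_smul hn x
  rw [← rieszIntegral_self hn a (norm_nonneg x) hx he hq, ← hxe]
  refine IsGreatest.isLUB ⟨⟨⟨e, by simpa using he⟩, rfl⟩, ?_⟩
  rintro _ ⟨l, rfl⟩
  have := rieszIntegral_le_self ha (norm_nonneg x) hx hq he (norm_coe_sph l)
  rwa [← hxe] at this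

theorem rieszIntegral_zero [NeZero n] (hn : 2 ≤ n) {q : ℝ} (hq : 0 ≤ q) (x : EuclideanSpace ℝ (Fin n))
    {l : EuclideanSpace ℝ (Fin n)} (hl : ‖l‖ = 1) :
    rieszIntegral 0 q x l = sphMoment n q := by
  simp [rieszIntegral, integral_sigma_abs_rpow hn hl hq]

/-- For `a = 1` the even kernel is constant, so the direction of `l` does not matter. -/
theorem rieszIntegral_one [NeZero n] (hn : 2 ≤ n) {q : ℝ} (hq : 0 ≤ q) {x : EuclideanSpace ℝ (Fin n)}
    (hx : ‖x‖ < 1) {l : EuclideanSpace ℝ (Fin n)} (hl : ‖l‖ = 1) :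
    rieszIntegral 1 q x l = sphMoment n q * (1 + ‖x‖ ^ 2) := by
  obtain ⟨e, he, hxe⟩ := exists_norm_eq_one_eq_norm_smul hn x
  nth_rw 1 [hxe]
  rw [rieszIntegral_smul_eq (norm_nonneg x) hx hq he]
  have : ∀ t, evenKernel 1 ‖x‖ t = 2 * (1 + ‖x‖ ^ 2) := fun t => by
    simp only [evenKernel, Real.rpow_one]; ring
  simp only [this]
  rw [integral_const_mul, integral_sigma_abs_rpow hn hl hq]
  ring

theorem nonempty_sph [NeZero n] : Nonempty (Sph n) :=
  ⟨⟨EuclideanSpace.single 0 1, by simp⟩⟩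

theorem sphMoment_zero (n : ℕ) [NeZero n] : sphMoment n 0 = 1 := by
  have hn0 : (0 : ℝ) < n := Nat.cast_pos.2 (Nat.pos_of_neZero n)
  have h := Real.Gamma_pos_of_pos (show 0 < (n : ℝ) / 2 by positivity)
  rw [sphMoment, zero_add, zero_add, Real.Gamma_one_half_eq]
  field_simp

/-- The case `B = 0` of `rieszIntegral_orthogonal`; it identifies the `₂F₁` in `termJ` as an
integral. -/
theorem integral_norm_sub_rpow [NeZero n] (hn : 2 ≤ n) (a : ℝ) {x : EuclideanSpace ℝ (Fin n)} (hx : ‖x‖ < 1) :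
    ∫ η : Sph n, ‖(η : EuclideanSpace ℝ (Fin n)) - x‖ ^ (2 * a) ∂sigma n =
      ordinaryHypergeometric (-a) (1 - a - n / 2) ((n : ℝ) / 2) (‖x‖ ^ 2) := by
  obtain ⟨e, he, hxe⟩ := exists_norm_eq_one_eq_norm_smul hn x
  obtain ⟨m, hm, hem⟩ := exists_norm_eq_one_inner_eq_zero hn e
  have := rieszIntegral_orthogonal a (norm_nonneg x) hx he hm hem le_rfl
  rw [← hxe, sphMoment_zero, one_mul, zero_add] at this
  simpa [rieszIntegral] using this

/-- Without boundedness the real supremum in `gradBound` would default to `0` and bound nothing. -/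
theorem bddAbove_range_intI [NeZero n] (hn : 2 ≤ n) (α : ℝ) {q : ℝ} (hq : 0 ≤ q)
    {x : EuclideanSpace ℝ (Fin n)} (hx : ‖x‖ < 1) :
    BddAbove (Set.range fun l : Sph n => intI n α q x l) := by
  simp only [intI_eq_rieszIntegral]
  rcases le_or_gt ((((n : ℝ) - α) * q - 2 * n + 2) / 2) 0 with h | h
  · exact (isLUB_rieszIntegral_of_convex hn (Or.inl h) hq hx).bddAbove
  · rcases le_or_gt 1 ((((n : ℝ) - α) * q - 2 * n + 2) / 2) with h1 | h1
    · exact (isLUB_rieszIntegral_of_convex hn (Or.inr h1) hq hx).bddAbove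
    · exact (isLUB_rieszIntegral_of_concave hn h.le h1.le hq hx).bddAbove

end Supremum

/-! ### The gradient estimate and its sharpness. -/

section GradientEstimate

variable {n : ℕ}

theorem termJ_eq [NeZero n] (hn : 2 ≤ n) (α q : ℝ) {x : EuclideanSpace ℝ (Fin n)} (hx : ‖x‖ < 1) :
    termJ n α q x = q * (|2 - α - (n : ℝ)| / (n - α) * ‖x‖) *
      (1 + |2 - α - (n : ℝ)| / (n - α) * ‖x‖) ^ (q - 1) *
      ∫ η : Sph n, ‖(η : EuclideanSpace ℝ (Fin n)) - x‖ ^ (((n : ℝ) - α) * q - 2 * n + 2)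
        ∂sigma n := by
  have h := integral_norm_sub_rpow hn ((((n : ℝ) - α) * q - 2 * n + 2) / 2) hx
  rw [mul_div_cancel₀ _ (two_ne_zero' ℝ)] at h
  rw [h, termJ]
  have e1 : -((((n : ℝ) - α) * q - 2 * n + 2) / 2) = n - 1 - q * (n - α) / 2 := by ring
  have e2 : 1 - (((n : ℝ) - α) * q - 2 * n + 2) / 2 - n / 2 = (n - q * (n - α)) / 2 := by ring
  rw [e1, e2]
  ring

theorem termJ_nonneg [NeZero n] (hn : 2 ≤ n) {α q : ℝ} (hα : α < 1) (hq : 0 ≤ q)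
    {x : EuclideanSpace ℝ (Fin n)} (hx : ‖x‖ < 1) : 0 ≤ termJ n α q x := by
  have hn' : (2 : ℝ) ≤ n := by exact_mod_cast hn
  have hnα : 0 < (n : ℝ) - α := by linarith
  rw [termJ_eq hn α q hx]
  have : 0 ≤ ∫ η : Sph n, ‖(η : EuclideanSpace ℝ (Fin n)) - x‖ ^ (((n : ℝ) - α) * q - 2 * n + 2)
      ∂sigma n := integral_nonneg fun η => Real.rpow_nonneg (norm_nonneg _) _
  positivity

theorem intI_nonneg (α q : ℝ) (x : EuclideanSpace ℝ (Fin n)) (l : Sph n) : 0 ≤ intI n α q x l :=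
  integral_nonneg fun _ => mul_nonneg (Real.rpow_nonneg (norm_nonneg _) _)
    (Real.rpow_nonneg (abs_nonneg _) _)

/-- Pointwise, `add_rpow_le` with `A = |⟨η, l⟩|` and `B = |β| |x|`; bounding `A ≤ 1` in the
correction makes it independent of `l`, and its integral is `termJ`. -/
theorem integral_abs_inner_sub_smul_le [NeZero n] (hn : 2 ≤ n) {α q : ℝ} (hα : α < 1) (hq : 1 ≤ q)
    {x : EuclideanSpace ℝ (Fin n)} (hx : ‖x‖ < 1) (l : Sph n) :
    ∫ η : Sph n, ‖(η : EuclideanSpace ℝ (Fin n)) - x‖ ^ (((n : ℝ) - α) * q - 2 * n + 2) *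
        |inner ℝ ((η : EuclideanSpace ℝ (Fin n)) - (((n : ℝ) - 2 + α) / (n - α)) • x)
          (l : EuclideanSpace ℝ (Fin n))| ^ q ∂sigma n ≤
      intI n α q x l + termJ n α q x := by
  have hn' : (2 : ℝ) ≤ n := by exact_mod_cast hn
  have hnα : 0 < (n : ℝ) - α := by linarith
  have hq0 : 0 ≤ q := by linarith
  set b := (((n : ℝ) - α) * q - 2 * n + 2) with hb
  set β := |2 - α - (n : ℝ)| / (n - α) with hβ
  have hβ0 : 0 ≤ β := by positivity
  have hβabs : |((n : ℝ) - 2 + α) / (n - α)| = β := by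
    rw [abs_div, abs_of_pos hnα, hβ, ← abs_neg]; congr 2; ring
  have hc := continuous_norm_sub_rpow hx b
  have habs : ∀ v : EuclideanSpace ℝ (Fin n),
      Continuous fun η : Sph n => |inner ℝ ((η : EuclideanSpace ℝ (Fin n)) - v)
        (l : EuclideanSpace ℝ (Fin n))| ^ q := fun v =>
    (continuous_abs_rpow hq0).comp (by fun_prop)
  have habs0 : Continuous fun η : Sph n => |inner ℝ (η : EuclideanSpace ℝ (Fin n))
        (l : EuclideanSpace ℝ (Fin n))| ^ q := by simpa using habs 0
  rw [termJ_eq hn α q hx, intI, ← hb, ← hβ, ← integral_const_mul, ← integral_add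
    (integrable_sigma_of_continuous (hc.fun_mul habs0))
    (integrable_sigma_of_continuous (continuous_const.fun_mul hc))]
  refine integral_mono (integrable_sigma_of_continuous (hc.fun_mul (habs _)))
    (integrable_sigma_of_continuous ((hc.fun_mul habs0).fun_add (continuous_const.fun_mul hc))) fun η => ?_
  have hN : 0 ≤ ‖(η : EuclideanSpace ℝ (Fin n)) - x‖ ^ b := Real.rpow_nonneg (norm_nonneg _) _
  have hA1 := abs_inner_sph_le η (norm_coe_sph l)
  have hA := abs_nonneg (inner ℝ (η : EuclideanSpace ℝ (Fin n)) (l : EuclideanSpace ℝ (Fin n)))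
  have hB : 0 ≤ β * ‖x‖ := by positivity
  have hle : |inner ℝ ((η : EuclideanSpace ℝ (Fin n)) - (((n : ℝ) - 2 + α) / (n - α)) • x)
      (l : EuclideanSpace ℝ (Fin n))| ≤
      |inner ℝ (η : EuclideanSpace ℝ (Fin n)) (l : EuclideanSpace ℝ (Fin n))| + β * ‖x‖ := by
    rw [inner_sub_left, inner_smul_left, conj_trivial]
    refine (abs_sub _ _).trans (add_le_add_right ?_ _)
    rw [abs_mul, hβabs]
    refine mul_le_mul_of_nonneg_left ?_ hβ0
    simpa using abs_real_inner_le_norm x (l : EuclideanSpace ℝ (Fin n))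
  have h1 := (Real.rpow_le_rpow (abs_nonneg _) hle hq0).trans (add_rpow_le hA hB hq)
  have h2 := mul_le_mul_of_nonneg_left (Real.rpow_le_rpow (add_nonneg hA hB)
    (add_le_add_left hA1 (β * ‖x‖)) (sub_nonneg.2 hq)) (mul_nonneg hq0 hB)
  have h3 := mul_le_mul_of_nonneg_left (h1.trans (add_le_add_right h2 _)) hN
  refine h3.trans (le_of_eq ?_)
  ring

theorem gradBound_eq [NeZero n] (hn : 2 ≤ n) {α q : ℝ} (hα : α < 1) (hq : 1 ≤ q)
    {x : EuclideanSpace ℝ (Fin n)} (hx : ‖x‖ < 1) :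
    gradBound n α q x = (((n - α) * cConst n α) ^ q *
      (1 - ‖x‖ ^ 2) ^ (-((n : ℝ) * (q - 1) + 1)) *
      ((⨆ l : Sph n, intI n α q x l) + termJ n α q x)) ^ (1 / q) := by
  have hn' : (2 : ℝ) ≤ n := by exact_mod_cast hn
  have hnα : 0 < (n : ℝ) - α := by linarith
  have hκ := one_sub_norm_sq_pos hx
  have hC := cConst_pos (by omega : 0 < n) hα
  have hS : 0 ≤ (⨆ l : Sph n, intI n α q x l) + termJ n α q x :=
    add_nonneg (Real.iSup_nonneg fun l => intI_nonneg α q x l)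
      (termJ_nonneg hn hα (by linarith) hx)
  rw [gradBound, Real.mul_rpow (by positivity) hS, Real.mul_rpow (by positivity) (by positivity),
    ← Real.rpow_mul (by positivity), ← Real.rpow_mul hκ.le, mul_one_div_cancel (by linarith),
    Real.rpow_one, neg_mul, Real.rpow_neg hκ.le, mul_one_div]
  rfl

theorem integral_abs_inner_kernelGrad_le [NeZero n] (hn : 2 ≤ n) {α q : ℝ} (hα : α < 1)
    (hq : 1 ≤ q) {x : EuclideanSpace ℝ (Fin n)} (hx : ‖x‖ < 1) (l : Sph n) :
    (∫ ζ : Sph n, |inner ℝ (kernelGrad n α x ζ) (l : EuclideanSpace ℝ (Fin n))| ^ q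
      ∂sigma n) ^ (1 / q) ≤ gradBound n α q x := by
  have hn' : (2 : ℝ) ≤ n := by exact_mod_cast hn
  have hnα : 0 < (n : ℝ) - α := by linarith
  have hκ := one_sub_norm_sq_pos hx
  have hC := cConst_pos (by omega : 0 < n) hα
  rw [gradBound_eq hn hα hq hx]
  refine Real.rpow_le_rpow (integral_nonneg fun _ => Real.rpow_nonneg (abs_nonneg _) _) ?_
    (by positivity)
  rw [integral_abs_inner_kernelGrad hα q hx]
  refine mul_le_mul_of_nonneg_left ?_ (by positivity)
  exact (integral_abs_inner_sub_smul_le hn hα hq hx l).trans (add_le_add_left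
    (le_ciSup (bddAbove_range_intI hn α (by linarith) hx) l) _)

theorem norm_gradient_poisson_le [NeZero n] (hn : 2 ≤ n) {α : ℝ} (hα : α < 1) {p : ENNReal}
    (hp : 1 ≤ p) {q : ℝ} (hq : 1 ≤ q) [ENNReal.HolderConjugate p (ENNReal.ofReal q)]
    {x : EuclideanSpace ℝ (Fin n)} (hx : ‖x‖ < 1) {φ : Sph n → ℝ} (hφ : MemLp φ p (sigma n)) :
    ‖gradient (poisson n α φ) x‖ ≤ gradBound n α q x * lpNorm n p φ := by
  have hi : Integrable φ (sigma n) := hφ.integrable hp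
  have key : ∀ l : Sph n, inner ℝ (gradient (poisson n α φ) x) (l : EuclideanSpace ℝ (Fin n)) ≤
      gradBound n α q x * lpNorm n p φ := fun l => by
    rw [inner_gradient_poisson α hi hx, mul_comm]
    have hc : Continuous fun ζ : Sph n =>
        inner ℝ (kernelGrad n α x ζ) (l : EuclideanSpace ℝ (Fin n)) :=
      (continuous_kernelGrad α hx).inner continuous_const
    refine (le_abs_self _).trans ((abs_integral_mul_le_of_memLp (q := q) (by linarith) hφ
      (hc.memLp_of_hasCompactSupport (HasCompactSupport.of_compactSpace _))).trans ?_)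
    exact mul_le_mul_of_nonneg_left (integral_abs_inner_kernelGrad_le hn hα hq hx l)
      ENNReal.toReal_nonneg
  rcases eq_or_ne (gradient (poisson n α φ) x) 0 with h0 | h0
  · obtain ⟨m, hm, -⟩ := exists_norm_eq_one_inner_eq_zero hn (0 : EuclideanSpace ℝ (Fin n))
    have := key ⟨m, by simpa using hm⟩
    rw [h0, inner_zero_left] at this
    rwa [h0, norm_zero]
  -- The direction of the gradient itself recovers its norm.
  · have := key ⟨‖gradient (poisson n α φ) x‖⁻¹ • gradient (poisson n α φ) x, by
      simpa using norm_inv_norm_smul h0⟩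
    rw [inner_smul_right, real_inner_self_eq_norm_sq, pow_two,
      inv_mul_cancel_left₀ (norm_ne_zero_iff.2 h0)] at this
    exact this

/-- When `β x = 0` the correction `J` vanishes and the `L^q` norm for each `l` is given exactly by
`I`; duality bounds each of them by `K`, and then the supremum. -/
theorem gradBound_le_of_forall_memLp [NeZero n] (hn : 2 ≤ n) {α : ℝ} (hα : α < 1) {p : ENNReal}
    (hp : 1 < p) {q : ℝ} (hq : 1 ≤ q) [ENNReal.HolderConjugate p (ENNReal.ofReal q)]
    {x : EuclideanSpace ℝ (Fin n)} (hx : ‖x‖ < 1) (hxα : x = 0 ∨ α = 2 - n) {K : ℝ}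
    (hK : ∀ φ : Sph n → ℝ, MemLp φ p (sigma n) →
      ‖gradient (poisson n α φ) x‖ ≤ K * lpNorm n p φ) : gradBound n α q x ≤ K := by
  have hn' : (2 : ℝ) ≤ n := by exact_mod_cast hn
  have hnα : 0 < (n : ℝ) - α := by linarith
  have hq0 : 0 < q := by linarith
  have hκ := one_sub_norm_sq_pos hx
  have hC := cConst_pos (by omega : 0 < n) hα
  have hK0 : 0 ≤ K := by
    have := (norm_nonneg _).trans (hK (fun _ => 1) (memLp_const 1))
    rwa [lpNorm, eLpNorm_const _ (zero_lt_one.trans hp).ne' (NeZero.ne _), measure_univ,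
      ENNReal.one_rpow, mul_one, enorm_one, ENNReal.toReal_one, mul_one] at this
  have hβ : (((n : ℝ) - 2 + α) / (n - α)) • x = 0 := by
    rcases hxα with rfl | rfl
    · simp
    · have : (n : ℝ) - 2 + (2 - n) = 0 := by ring
      rw [this, zero_div, zero_smul]
  have hJ : termJ n α q x = 0 := by
    rcases hxα with rfl | rfl
    · simp [termJ]
    · simp [termJ]
  have := nonempty_sph (n := n)
  have hP : 0 < ((n - α) * cConst n α) ^ q * (1 - ‖x‖ ^ 2) ^ (-((n : ℝ) * (q - 1) + 1)) := by
    positivity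
  have key : ∀ l : Sph n, ((n - α) * cConst n α) ^ q *
      (1 - ‖x‖ ^ 2) ^ (-((n : ℝ) * (q - 1) + 1)) * intI n α q x l ≤ K ^ q := fun l => by
    have hc : Continuous fun ζ : Sph n =>
        inner ℝ (kernelGrad n α x ζ) (l : EuclideanSpace ℝ (Fin n)) :=
      (continuous_kernelGrad α hx).inner continuous_const
    obtain ⟨M, hM⟩ := (isCompact_univ (X := Sph n)).exists_bound_of_continuousOn hc.continuousOn
    have h1 := rpow_integral_le_of_forall_memLp (μ := sigma n) hp hq hc.measurable
      (fun ζ => hM ζ trivial) hK0 fun φ hφ => by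
        rw [← inner_gradient_poisson α (hφ.integrable hp.le) hx]
        refine (real_inner_le_norm _ _).trans ?_
        rw [norm_coe_sph, mul_one]
        exact hK φ hφ
    have h0 : 0 ≤ ∫ ζ : Sph n, |inner ℝ (kernelGrad n α x ζ) (l : EuclideanSpace ℝ (Fin n))| ^ q
        ∂sigma n := integral_nonneg fun _ => Real.rpow_nonneg (abs_nonneg _) _
    have h2 := integral_abs_inner_kernelGrad hα q hx (l : EuclideanSpace ℝ (Fin n))
    simp only [hβ, sub_zero] at h2
    rw [one_div, Real.rpow_inv_le_iff_of_pos h0 hK0 hq0, h2] at h1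
    exact h1
  rw [gradBound_eq hn hα hq hx, hJ, add_zero, one_div, Real.rpow_inv_le_iff_of_pos
    (mul_nonneg hP.le (Real.iSup_nonneg fun l => intI_nonneg α q x l)) hK0 hq0, ← le_div_iff₀' hP]
  exact ciSup_le fun l => (le_div_iff₀' hP).2 (key l)

end GradientEstimate

end AlphaHarmonic

theorem theorem1p1 (n : ℕ) (hn : 3 ≤ n) (α : ℝ) (hα : α < 1)
    (p : ENNReal) (hp : 1 < p) (q : ℝ) (hpq : ENNReal.HolderConjugate p (ENNReal.ofReal q))
    (x : EuclideanSpace ℝ (Fin n)) (hx : ‖x‖ < 1) :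
    -- the gradient estimate
    (∀ φ : AlphaHarmonic.Sph n → ℝ, MemLp φ p (AlphaHarmonic.sigma n) →
      DifferentiableAt ℝ (AlphaHarmonic.poisson n α φ) x ∧
      ‖gradient (AlphaHarmonic.poisson n α φ) x‖ ≤
        AlphaHarmonic.gradBound n α q x * AlphaHarmonic.lpNorm n p φ) ∧
    -- the explicit value of the supremum of `I(α, q, x, l)` over `l`
    (q = (2 * n - 2) / (n - α) →
      IsLUB (Set.range fun l : AlphaHarmonic.Sph n => AlphaHarmonic.intI n α q x l)
        (Real.Gamma (n / 2) * Real.Gamma ((3 * n - α - 2) / (2 * n - 2 * α)) /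
          (√Real.pi * Real.Gamma ((n ^ 2 + 2 * n - α * n - 2) / (2 * n - 2 * α))))) ∧
    (q = 2 * n / (n - α) →
      IsLUB (Set.range fun l : AlphaHarmonic.Sph n => AlphaHarmonic.intI n α q x l)
        (Real.Gamma (n / 2) * Real.Gamma ((3 * n - α) / (2 * n - 2 * α)) /
          (√Real.pi * Real.Gamma ((n ^ 2 + 2 * n - α * n) / (2 * n - 2 * α))) *
          (1 + ‖x‖ ^ 2))) ∧
    ((2 * n - 2) / (n - α) < q → q < 2 * n / (n - α) →
      IsLUB (Set.range fun l : AlphaHarmonic.Sph n => AlphaHarmonic.intI n α q x l)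
        (Real.Gamma (n / 2) * Real.Gamma ((q + 1) / 2) /
          (√Real.pi * Real.Gamma ((q + n) / 2)) *
          ordinaryHypergeometric (n - 1 - (n - α) * q / 2) ((n - (n + 1 - α) * q) / 2)
            ((q + n) / 2) (‖x‖ ^ 2))) ∧
    (q < (2 * n - 2) / (n - α) ∨ 2 * n / (n - α) < q →
      IsLUB (Set.range fun l : AlphaHarmonic.Sph n => AlphaHarmonic.intI n α q x l)
        ((1 + ‖x‖ ^ 2) ^ ((n - α) * q / 2 - n + 1) *
          (Real.Gamma (n / 2) * Real.Gamma ((q + 1) / 2) /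
            (√Real.pi * Real.Gamma ((q + n) / 2))) *
          AlphaHarmonic.hyp32 ((2 * n - 2 - (n - α) * q) / 4) ((2 * n - (n - α) * q) / 4)
            ((q + 1) / 2) (1 / 2) ((q + n) / 2) (4 * ‖x‖ ^ 2 / (1 + ‖x‖ ^ 2) ^ 2))) ∧
    -- sharpness: the factor is the best constant
    (x = 0 ∨ α = 2 - n →
      IsLeast {K : ℝ | ∀ φ : AlphaHarmonic.Sph n → ℝ, MemLp φ p (AlphaHarmonic.sigma n) →
        ‖gradient (AlphaHarmonic.poisson n α φ) x‖ ≤ K * AlphaHarmonic.lpNorm n p φ}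
        (AlphaHarmonic.gradBound n α q x)) := by
  have : NeZero n := ⟨by omega⟩
  have hn2 : 2 ≤ n := by omega
  have hn' : (3 : ℝ) ≤ n := by exact_mod_cast hn
  have hnα : 0 < (n : ℝ) - α := by linarith
  have hq : 1 ≤ q := ENNReal.one_le_ofReal.1 (ENNReal.HolderConjugate.one_le (ENNReal.ofReal q) p)
  have hq0 : 0 ≤ q := by linarith
  have h2nα : 2 * (n : ℝ) - 2 * α ≠ 0 := by linarith
  refine ⟨fun φ hφ => ⟨?_, AlphaHarmonic.norm_gradient_poisson_le hn2 hα hp.le hq hx hφ⟩,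
    fun h => ?_, fun h => ?_, fun h1 h2 => ?_, fun h => ?_, fun h => ⟨fun φ hφ => ?_, fun K hK => ?_⟩⟩
  · exact (AlphaHarmonic.hasFDerivAt_poisson α (hφ.integrable hp.le) hx).2.differentiableAt
  -- The four regimes of `q` are those of the exponent `a`: `a = 0`, `a = 1`, `0 < a < 1`, and `a <
  -- 0` or `a > 1`.
  · have ha : (((n : ℝ) - α) * q - 2 * n + 2) / 2 = 0 := by
      rw [h]; field_simp; ring
    have h1 : (3 * (n : ℝ) - α - 2) / (2 * n - 2 * α) = (q + 1) / 2 := by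
      rw [h]; field_simp; ring
    have h2 : ((n : ℝ) ^ 2 + 2 * n - α * n - 2) / (2 * n - 2 * α) = (q + n) / 2 := by
      rw [h]; field_simp; ring
    simp only [AlphaHarmonic.intI_eq_rieszIntegral, ha, h1, h2,
      AlphaHarmonic.rieszIntegral_zero hn2 hq0 x (AlphaHarmonic.norm_coe_sph _)]
    rw [@Set.range_const _ _ AlphaHarmonic.nonempty_sph]
    exact isLUB_singleton
  · have ha : (((n : ℝ) - α) * q - 2 * n + 2) / 2 = 1 := by
      rw [h]; field_simp; ring
    have h1 : (3 * (n : ℝ) - α) / (2 * n - 2 * α) = (q + 1) / 2 := by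
      rw [h]; field_simp; ring
    have h2 : ((n : ℝ) ^ 2 + 2 * n - α * n) / (2 * n - 2 * α) = (q + n) / 2 := by
      rw [h]; field_simp; ring
    simp only [AlphaHarmonic.intI_eq_rieszIntegral, ha, h1, h2,
      AlphaHarmonic.rieszIntegral_one hn2 hq0 hx (AlphaHarmonic.norm_coe_sph _)]
    rw [@Set.range_const _ _ AlphaHarmonic.nonempty_sph]
    exact isLUB_singleton
  · rw [div_lt_iff₀ hnα] at h1
    rw [lt_div_iff₀ hnα] at h2
    simp only [AlphaHarmonic.intI_eq_rieszIntegral]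
    have e1 : (n : ℝ) - 1 - (n - α) * q / 2 = -((((n : ℝ) - α) * q - 2 * n + 2) / 2) := by ring
    have e2 : ((n : ℝ) - (n + 1 - α) * q) / 2 =
        1 - (((n : ℝ) - α) * q - 2 * n + 2) / 2 - (q + n) / 2 := by ring
    rw [e1, e2]
    exact AlphaHarmonic.isLUB_rieszIntegral_of_concave hn2 (by linarith) (by linarith) hq0 hx
  · rw [lt_div_iff₀ hnα, div_lt_iff₀ hnα] at h
    simp only [AlphaHarmonic.intI_eq_rieszIntegral]
    have e1 : ((n : ℝ) - α) * q / 2 - n + 1 = (((n : ℝ) - α) * q - 2 * n + 2) / 2 := by ring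
    have e2 : (2 * (n : ℝ) - 2 - (n - α) * q) / 4 =
        -((((n : ℝ) - α) * q - 2 * n + 2) / 2) / 2 := by ring
    have e3 : (2 * (n : ℝ) - (n - α) * q) / 4 =
        (1 - (((n : ℝ) - α) * q - 2 * n + 2) / 2) / 2 := by ring
    rw [e1, e2, e3]
    exact AlphaHarmonic.isLUB_rieszIntegral_of_convex hn2
      (h.imp (fun h => by linarith) fun h => by linarith) hq0 hx
  · exact AlphaHarmonic.norm_gradient_poisson_le hn2 hα hp.le hq hx hφ
  · exact AlphaHarmonic.gradBound_le_of_forall_memLp hn2 hα hp hq hx h hK
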